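/- **Setting.** Let $m=(m_0,m_1,\dots)$ be a bounded sequence of integers $m_k\ge 2$, let $G_m=\prod_{k\ge 0}\mathbb{Z}/m_k\mathbb{Z}$ be the corresponding (bounded) Vilenkin group, and let $\mu$ be its normalized Haar measure. Put $M_0=1$, $M_{k+1}=m_kM_k$, write $n=\sum_k n_kM_k$ with $0\le n_k<m_k$, and let $\psi_n(x)=\prod_k \exp(2\pi i\,n_kx_k/m_k)$, $n\ge 0$, be the Vilenkin system. Let $\mathcal F_n$ be the $\sigma$-algebra generated by the sets $I_n(x)=\{y: y_0=x_0,\dots,y_{n-1}=x_{n-1}\}$. For $0<p<1$, $H_p(G_m)$ is the space of martingales $f=(f_n)_{n\ge0}$ with respect to $(\mathcal F_n)$ such that $\|f\|_{H_p}:=\|\sup_n|f_n|\,\|_p<\infty$, where $\|g\|_p=(\int_{G_m}|g|^p\,d\mu)^{1/p}$. For a martingale $f$ let $\widehat f(i)=\lim_{k\to\infty}\int_{G_m}f_k\overline{\psi_i}\,d\mu$, $S_nf=\sum_{i=0}^{n-1}\widehat f(i)\psi_i$, and let $$L_nf=\frac1{l_n}\sum_{k=0}^{n-1}\frac{S_kf}{n-k},\qquad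 l_n=\sum_{j=1}^n\frac1j\quad(n\ge1),\qquad L_0f=0,$$ be the Nörlund logarithmic means. An operator $T$ is bounded from $H_p(G_m)$ to $L_p(G_m)$ if there is a constant $C<\infty$ with $\|Tf\|_p\le C\|f\|_{H_p}$ for all $f\in H_p(G_m)$. **Theorem.** Let $0<p<1$. (a) The maximal operator $f\mapsto\sup_{n\in\mathbb N}\dfrac{|L_nf|}{(n+1)^{1/p-1}}$ is bounded from $H_p(G_m)$ to $L_p(G_m)$. (b) Let $\varphi:\{1,2,\dots\}\to[1,\infty)$ be a non-decreasing function with $$\limsup_{n\to\infty}\frac{n^{1/p-1}}{\varphi(n)\log n}=+\infty .$$ Then the maximal operator $f\mapsto\sup_{n\in\mathbb N}\dfrac{|L_nf|}{\varphi(n+1)}$ is not bounded from $H_p(G_m)$ to $L_p(G_m)$; moreover, there is a martingale $f\in H_p(G_m)$ with $\left\|\sup_{n\in\mathbb N}\dfrac{|L_nf|}{\varphi(n+1)}\right\|_p=\infty$. -/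

import Mathlib

open MeasureTheory Filter

noncomputable section

namespace Vilenkin

/-- The Vilenkin group `G_m`: the complete direct product of the cyclic groups `ℤ/m_kℤ`. -/
abbrev VGroup (m : ℕ → ℕ) : Type := (k : ℕ) → ZMod (m k)

/-- The normalized Haar measure on `G_m`: the product of the uniform probability measures on
the factors `ℤ/m_kℤ`. -/
def haar (m : ℕ → ℕ) [∀ k, (m k).AtLeastTwo] : Measure (VGroup m) :=
  Measure.infinitePi fun k => (PMF.uniformOfFintype (ZMod (m k))).toMeasure

/-- The generalized powers `M_0 = 1`, `M_{k+1} = m_k M_k`. -/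
def bigM (m : ℕ → ℕ) (k : ℕ) : ℕ := ∏ j ∈ Finset.range k, m j

/-- The `k`-th digit `n_k` of `n = ∑ n_k M_k`, `0 ≤ n_k < m_k`. -/
def digit (m : ℕ → ℕ) (n k : ℕ) : ℕ := n / bigM m k % m k

/-- The interval `I_n(x)`. -/
def interval (m : ℕ → ℕ) (n : ℕ) (x : VGroup m) : Set (VGroup m) :=
  {y | ∀ k < n, y k = x k}

/-- The generalized Rademacher function `r_k(x) = exp(2πi x_k / m_k)`. -/
def rademacher (m : ℕ → ℕ) (k : ℕ) (x : VGroup m) : ℂ :=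
  Complex.exp (2 * Real.pi * Complex.I * ((x k).val : ℂ) / (m k : ℂ))

/-- The Vilenkin function `ψ_n = ∏_k r_k ^ n_k`. Since all `m_k ≥ 2`, one has `n < 2 ^ n ≤ M_n`,
so that `n_k = 0` for `k ≥ n` and the infinite product stops at `k = n - 1` at the latest. -/
def psi (m : ℕ → ℕ) (n : ℕ) (x : VGroup m) : ℂ :=
  ∏ k ∈ Finset.range n, rademacher m k x ^ digit m n k

theorem measurableSet_interval (m : ℕ → ℕ) (n : ℕ) (x : VGroup m) :
    MeasurableSet (interval m n x) := by
  have h : interval m n x = ⋂ k ∈ Set.Iio n, {y : VGroup m | y k = x k} := by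
    ext y; simp [interval]
  rw [h]
  exact MeasurableSet.biInter (Set.to_countable _) fun k _ =>
    (measurable_pi_apply (X := fun k => ZMod (m k)) k) (measurableSet_singleton (x k))

/-- `I_n(x)` is the union of the finitely many intervals of rank `n + 1` that it contains. -/
theorem interval_eq_iUnion (m : ℕ → ℕ) (n : ℕ) (x : VGroup m) :
    interval m n x = ⋃ j : ZMod (m n), interval m (n + 1) (Function.update x n j) := by
  ext y
  simp only [interval, Set.mem_ofPred_eq, Set.mem_iUnion]
  constructor
  · intro h
    refine ⟨y n, fun k hk => ?_⟩
    rcases eq_or_ne k n with rfl | hkn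
    · simp
    · rw [Function.update_of_ne hkn]
      exact h k (by omega)
  · rintro ⟨j, h⟩ k hk
    have := h k (by omega)
    rwa [Function.update_of_ne (by omega)] at this

/-- The filtration `(F_n)`: `F_n` is the `σ`-algebra generated by the intervals `I_n(x)`. -/
def filt (m : ℕ → ℕ) [∀ k, (m k).AtLeastTwo] :
    Filtration ℕ (inferInstance : MeasurableSpace (VGroup m)) where
  seq n := MeasurableSpace.generateFrom (Set.range (interval m n))
  mono' := by
    refine monotone_nat_of_le_succ fun n => MeasurableSpace.generateFrom_le ?_
    rintro _ ⟨x, rfl⟩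
    rw [interval_eq_iUnion]
    exact MeasurableSet.iUnion fun j => MeasurableSpace.measurableSet_generateFrom ⟨_, rfl⟩
  le' n := by
    refine MeasurableSpace.generateFrom_le ?_
    rintro _ ⟨x, rfl⟩
    exact measurableSet_interval m n x

variable {m : ℕ → ℕ} [∀ k, (m k).AtLeastTwo]

/-- The `L_p` (quasi-)norm on `G_m` of a `[0, ∞]`-valued function. -/
def lpQNorm (p : ℝ) (F : VGroup m → ENNReal) : ENNReal :=
  eLpNorm F (ENNReal.ofReal p) (haar m)

/-- The maximal function `f^* = sup_n |f_n|`. -/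
def martMax (f : ℕ → VGroup m → ℂ) (x : VGroup m) : ENNReal :=
  ⨆ n : ℕ, ‖f n x‖ₑ

/-- The Hardy (quasi-)norm `‖f‖_{H_p} = ‖f^*‖_p`. -/
def hpNorm (p : ℝ) (f : ℕ → VGroup m → ℂ) : ENNReal :=
  lpQNorm p (martMax f)

variable (m) in
/-- The martingale Hardy space `H_p(G_m)`. -/
def HardySpace (p : ℝ) : Set (ℕ → VGroup m → ℂ) :=
  {f | Martingale f (filt m) (haar m) ∧ hpNorm p f < ⊤}

/-- The Vilenkin-Fourier coefficients of a martingale, `lim_k ∫ f_k conj(ψ_i)`. -/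
def coeff (f : ℕ → VGroup m → ℂ) (i : ℕ) : ℂ :=
  limUnder atTop fun k : ℕ => ∫ x, f k x * starRingEnd ℂ (psi m i x) ∂(haar m)

/-- The partial sum `S_n f = ∑_{i < n} f^(i) ψ_i`. -/
def partialSum (n : ℕ) (f : ℕ → VGroup m → ℂ) (x : VGroup m) : ℂ :=
  ∑ i ∈ Finset.range n, coeff f i * psi m i x

/-- `l_n = ∑_{k < n} 1 / (n - k)`. -/
def logWeight (n : ℕ) : ℂ := ∑ k ∈ Finset.range n, 1 / ((n : ℂ) - (k : ℂ))

/-- The Nörlund logarithmic mean `L_n f = (1 / l_n) ∑_{k < n} S_k f / (n - k)`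
(with `L_0 f = 0`). -/
def norlundLog (n : ℕ) (f : ℕ → VGroup m → ℂ) (x : VGroup m) : ℂ :=
  1 / logWeight n * ∑ k ∈ Finset.range n, partialSum k f x / ((n : ℂ) - (k : ℂ))

/-- The weighted maximal operator `f ↦ sup_n |L_n f| / w(n + 1)`, for a positive weight `w`. -/
def maxNorlundLog (w : ℕ+ → ℝ) (f : ℕ → VGroup m → ℂ) (x : VGroup m) : ENNReal :=
  ⨆ n : ℕ, ‖norlundLog n f x‖ₑ / ENNReal.ofReal (w n.succPNat)

/-- Boundedness of an operator from `H_p(G_m)` to `L_p(G_m)`. -/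
def BoundedHpLp (p : ℝ) (T : (ℕ → VGroup m → ℂ) → VGroup m → ENNReal) : Prop :=
  ∃ C : NNReal, ∀ f ∈ HardySpace m p, lpQNorm p (T f) ≤ C * hpNorm p f

end Vilenkin

end

set_option linter.unusedSectionVars false

noncomputable section

namespace Vilenkin

/-! ### Mixed-radix digits -/

section Digits

variable (m : ℕ → ℕ) [hm2 : ∀ k, (m k).AtLeastTwo]

/-! Positive part. `norlundLog n f` is a convex average of the partial sums `S_k f`, `k < n`, so it
suffices to control `S_n f / (n+1)^{1/p-1}`. Write `S_n f(x)` as the integral of `f_N` against a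
Dirichlet kernel, with `M_N` comparable to `n`. The kernel is at most `∑_j M_{j+1} 1_{I_j(x)}`
(`enorm_dirichlet_radQuot_le`). Since `f_N` is constant on intervals of rank `N`, a reverse Hölder
inequality (`lintegral_interval_le_rpow`) replaces the `L_1` integral over `I_j(x)` by the `L_p`
quantity at the price `M_N^{1/p-1}`, which is exactly the weight. The resulting majorant
`intervalMajorant` does not depend on `n`. Subadditivity of `y ↦ y^p` and Tonelli bound its `p`-th
power integral by `∑_j M_j^{p-1}` times that of `f^*`, and the series converges because `p < 1`.

Negative part. Take `f = ∑_s c_s (D_{M_{s+1}} - D_{M_s})`, with `c` supported on a sparse sequence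
`N_k` where `c_{N_k} = 2^{-k} M_{N_k}^{1/p-1}`. Each block lives on `I_s(0)`, so `‖f‖_{H_p}^p` is
controlled by `∑_s c_s^p M_s^{p-1}`, a geometric series. In the mean of order `M_N + 2` the
coefficient of index `M_N` occurs only in the last partial sum, and contributes modulus `c_N /
l_{M_N+2}` at every point (`norm_coeff_div_harmonic_le`). The growth hypothesis lets `N_k` be chosen
so that this beats both the weight and all earlier coefficients, hence the maximal operator is
infinite everywhere. -/

theorem bigM_succ (k : ℕ) : bigM m (k + 1) = bigM m k * m k := Finset.prod_range_succ _ _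

theorem two_pow_le_bigM (k : ℕ) : 2 ^ k ≤ bigM m k := by
  induction k with
  | zero => simp [bigM]
  | succ k ih =>
    rw [bigM_succ, pow_succ]
    exact Nat.mul_le_mul ih (hm2 k).prop

theorem bigM_pos (k : ℕ) : 0 < bigM m k := lt_of_lt_of_le (by positivity) (two_pow_le_bigM m k)

theorem lt_bigM_self (n : ℕ) : n < bigM m n := Nat.lt_two_pow_self.trans_le (two_pow_le_bigM m n)

theorem bigM_strictMono : StrictMono (bigM m) := by
  refine strictMono_nat_of_lt_succ fun k => ?_
  rw [bigM_succ]
  have := bigM_pos m k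
  have := (hm2 k).prop
  nlinarith

theorem bigM_dvd {j k : ℕ} (h : j ≤ k) : bigM m j ∣ bigM m k :=
  Finset.prod_dvd_prod_of_subset _ _ _ (Finset.range_mono h)

theorem digit_eq_zero {n k : ℕ} (h : n < bigM m k) : digit m n k = 0 := by
  simp [digit, Nat.div_eq_of_lt h]

theorem digit_mul_bigM_of_lt (q : ℕ) {j k : ℕ} (h : j < k) : digit m (q * bigM m k) j = 0 := by
  obtain ⟨c, hc⟩ := bigM_dvd m (Nat.succ_le_of_lt h)
  have : q * bigM m k = bigM m j * (m j * (c * q)) := by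
    rw [hc, bigM_succ]; ring
  rw [digit, this, Nat.mul_div_cancel_left _ (bigM_pos m j), Nat.mul_mod_right]

/-- No carry occurs: `q * M_k` only has digits at places `≥ k`, and `r < M_k` only at places `< k`.
-/
theorem digit_add (q : ℕ) {r k : ℕ} (hr : r < bigM m k) (j : ℕ) :
    digit m (q * bigM m k + r) j = digit m (q * bigM m k) j + digit m r j := by
  rcases lt_or_ge j k with h | h
  · rw [digit_mul_bigM_of_lt m q h, zero_add]
    obtain ⟨c, hc⟩ := bigM_dvd m (Nat.succ_le_of_lt h)
    have : q * bigM m k + r = r + bigM m j * (m j * (c * q)) := by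
      rw [hc, bigM_succ]; ring
    rw [digit, this, Nat.add_mul_div_left _ _ (bigM_pos m j), Nat.add_mul_mod_self_left, digit]
  · rw [digit_eq_zero m (hr.trans_le ((bigM_strictMono m).monotone h)), add_zero]
    obtain ⟨c, hc⟩ := bigM_dvd m h
    have hk := bigM_pos m k
    rw [digit, digit, hc, ← Nat.div_div_eq_div_mul, ← Nat.div_div_eq_div_mul,
      Nat.mul_div_cancel _ hk, add_comm, Nat.add_mul_div_right _ _ hk, Nat.div_eq_of_lt hr, zero_add]

theorem digit_mul_bigM {a k : ℕ} (ha : a < m k) (j : ℕ) :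
    digit m (a * bigM m k) j = if j = k then a else 0 := by
  rcases lt_trichotomy j k with h | rfl | h
  · rw [digit_mul_bigM_of_lt m a h, if_neg h.ne]
  · rw [if_pos rfl, digit, Nat.mul_div_cancel _ (bigM_pos m j), Nat.mod_eq_of_lt ha]
  · rw [if_neg h.ne']
    refine digit_eq_zero m (lt_of_lt_of_le ?_ ((bigM_strictMono m).monotone h))
    rw [bigM_succ, mul_comm]
    exact Nat.mul_lt_mul_of_pos_left ha (bigM_pos m k)

end Digits

/-! ### Dirichlet kernels for abstract unimodular sequences -/

section PowerProducts

variable (m : ℕ → ℕ) [hm2 : ∀ k, (m k).AtLeastTwo]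

/-- The product `∏_k z_k ^ n_k` over the digits of `n`. -/
def digitProd (z : ℕ → ℂ) (n : ℕ) : ℂ := ∏ k ∈ Finset.range n, z k ^ digit m n k

/-- The Dirichlet sum `∑_{i < n} ∏_k z_k ^ i_k`. -/
def dirichlet (z : ℕ → ℂ) (n : ℕ) : ℂ := ∑ i ∈ Finset.range n, digitProd m z i

theorem psi_eq_digitProd (n : ℕ) (x : VGroup m) :
    psi m n x = digitProd m (fun k => rademacher m k x) n := rfl

theorem digitProd_eq_prod_range (z : ℕ → ℂ) {n K : ℕ} (h : n < bigM m K) :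
    digitProd m z n = ∏ k ∈ Finset.range K, z k ^ digit m n k := by
  have key : ∀ a b : ℕ, a ≤ b → n < bigM m a →
      ∏ k ∈ Finset.range a, z k ^ digit m n k = ∏ k ∈ Finset.range b, z k ^ digit m n k := by
    intro a b hab ha
    refine Finset.prod_subset (Finset.range_mono hab) fun k _ hk => ?_
    rw [Finset.mem_range, not_lt] at hk
    rw [digit_eq_zero m (ha.trans_le ((bigM_strictMono m).monotone hk)), pow_zero]
  rcases le_total n K with hnK | hnK
  · exact key n K hnK (lt_bigM_self m n)
  · exact (key K n hnK h).symm

theorem digitProd_add (z : ℕ → ℂ) (q : ℕ) {r k : ℕ} (hr : r < bigM m k) :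
    digitProd m z (q * bigM m k + r) = digitProd m z (q * bigM m k) * digitProd m z r := by
  set K := q * bigM m k + r with hK
  have hlt := lt_bigM_self m K
  rw [digitProd_eq_prod_range m z hlt,
    digitProd_eq_prod_range m z (show q * bigM m k < bigM m K by omega),
    digitProd_eq_prod_range m z (show r < bigM m K by omega), ← Finset.prod_mul_distrib]
  refine Finset.prod_congr rfl fun j _ => ?_
  rw [← pow_add, hK, digit_add m q hr j]

theorem digitProd_mul_bigM (z : ℕ → ℂ) {a k : ℕ} (ha : a < m k) :
    digitProd m z (a * bigM m k) = z k ^ a := by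
  have hlt : a * bigM m k < bigM m (k + 1) := by
    rw [bigM_succ, mul_comm]
    exact Nat.mul_lt_mul_of_pos_left ha (bigM_pos m k)
  rw [digitProd_eq_prod_range m z hlt, Finset.prod_eq_single k]
  · rw [digit_mul_bigM m ha, if_pos rfl]
  · intro j _ hj
    rw [digit_mul_bigM m ha, if_neg hj, pow_zero]
  · simp

theorem digitProd_mul (z w : ℕ → ℂ) (n : ℕ) :
    digitProd m (fun k => z k * w k) n = digitProd m z n * digitProd m w n := by
  simp [digitProd, mul_pow, Finset.prod_mul_distrib]

theorem digitProd_conj (z : ℕ → ℂ) (n : ℕ) :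
    digitProd m (fun k => starRingEnd ℂ (z k)) n = starRingEnd ℂ (digitProd m z n) := by
  simp [digitProd, map_prod]

theorem norm_digitProd {z : ℕ → ℂ} (hz : ∀ k, ‖z k‖ = 1) (n : ℕ) : ‖digitProd m z n‖ = 1 := by
  simp [digitProd, norm_prod, hz]

theorem dirichlet_mul_bigM_add (z : ℕ → ℂ) (q : ℕ) {r k : ℕ} (hr : r ≤ bigM m k) :
    dirichlet m z (q * bigM m k + r) =
      dirichlet m z (q * bigM m k) + digitProd m z (q * bigM m k) * dirichlet m z r := by
  rw [dirichlet, Finset.sum_range_add, dirichlet, dirichlet, Finset.mul_sum]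
  congr 1
  refine Finset.sum_congr rfl fun i hi => digitProd_add m z q ?_
  exact (Finset.mem_range.1 hi).trans_le hr

theorem dirichlet_mul_bigM (z : ℕ → ℂ) (q k : ℕ) :
    dirichlet m z (q * bigM m k) =
      (∑ a ∈ Finset.range q, digitProd m z (a * bigM m k)) * dirichlet m z (bigM m k) := by
  induction q with
  | zero => simp [dirichlet]
  | succ q ih =>
    rw [add_mul, one_mul, dirichlet_mul_bigM_add m z q le_rfl, ih, Finset.sum_range_succ, add_mul]

/-- Summing over all digit strings of length `k` factorizes, one geometric sum per digit. A single
`z j ≠ 1` that is an `m j`-th root of unity therefore kills the kernel. -/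
theorem dirichlet_bigM (z : ℕ → ℂ) (k : ℕ) :
    dirichlet m z (bigM m k) = ∏ j ∈ Finset.range k, ∑ a ∈ Finset.range (m j), z j ^ a := by
  induction k with
  | zero => simp [dirichlet, bigM, digitProd]
  | succ k ih =>
    rw [bigM_succ, mul_comm, dirichlet_mul_bigM, ih, Finset.prod_range_succ, mul_comm]
    congr 1
    exact Finset.sum_congr rfl fun a ha => digitProd_mul_bigM m z (Finset.mem_range.1 ha)

theorem dirichlet_bigM_of_eq_one {z : ℕ → ℂ} {k : ℕ} (hz : ∀ j < k, z j = 1) :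
    dirichlet m z (bigM m k) = bigM m k := by
  rw [dirichlet_bigM, bigM, Nat.cast_prod]
  refine Finset.prod_congr rfl fun j hj => ?_
  simp [hz j (Finset.mem_range.1 hj)]

theorem dirichlet_bigM_of_ne_one {z : ℕ → ℂ} {j k : ℕ} (hj : j < k) (h1 : z j ≠ 1)
    (hroot : z j ^ m j = 1) : dirichlet m z (bigM m k) = 0 := by
  rw [dirichlet_bigM]
  refine Finset.prod_eq_zero (Finset.mem_range.2 hj) ?_
  rw [geom_sum_eq h1, hroot, sub_self, zero_div]

theorem norm_dirichlet_le {z : ℕ → ℂ} (hz : ∀ k, ‖z k‖ = 1) (n : ℕ) :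
    ‖dirichlet m z n‖ ≤ n := by
  refine (norm_sum_le _ _).trans ?_
  simp [norm_digitProd m hz]

/-- Complete blocks of length `M_k` cancel, so only an incomplete block of fewer than `M_k`
unimodular terms survives, whatever the size of `n`. -/
theorem norm_dirichlet_le_bigM {z : ℕ → ℂ} (hz : ∀ k, ‖z k‖ = 1) {k : ℕ}
    (h0 : dirichlet m z (bigM m k) = 0) (n : ℕ) : ‖dirichlet m z n‖ ≤ bigM m k := by
  have hr := Nat.mod_lt n (bigM_pos m k)
  rw [← Nat.div_add_mod' n (bigM m k), dirichlet_mul_bigM_add m z _ hr.le, dirichlet_mul_bigM, h0,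
    mul_zero, zero_add, norm_mul, norm_digitProd m hz, one_mul]
  exact (norm_dirichlet_le m hz _).trans (by exact_mod_cast hr.le)

end PowerProducts

/-! ### Vilenkin characters and the pointwise kernel estimate -/

section Characters

variable (m : ℕ → ℕ) [hm2 : ∀ k, (m k).AtLeastTwo]

theorem rademacher_eq_toCircle (k : ℕ) (x : VGroup m) :
    rademacher m k x = (ZMod.toCircle (x k) : ℂ) := by
  rw [rademacher, ZMod.toCircle_apply]

theorem norm_rademacher (k : ℕ) (x : VGroup m) : ‖rademacher m k x‖ = 1 := by
  rw [rademacher_eq_toCircle, Circle.norm_coe]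

/-- The quotient `r_k(x) / r_k(t)` of two values of a Rademacher function. -/
def radQuot (x t : VGroup m) (k : ℕ) : ℂ := rademacher m k x * starRingEnd ℂ (rademacher m k t)

theorem norm_radQuot (x t : VGroup m) (k : ℕ) : ‖radQuot m x t k‖ = 1 := by
  simp [radQuot, norm_rademacher]

theorem radQuot_eq_toCircle (x t : VGroup m) (k : ℕ) :
    radQuot m x t k = (ZMod.toCircle (x k - t k) : ℂ) := by
  rw [radQuot, rademacher_eq_toCircle, rademacher_eq_toCircle, AddChar.map_sub_eq_div,
    Circle.coe_div, div_eq_mul_inv, ← Circle.coe_inv, Circle.coe_inv_eq_conj]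

theorem radQuot_eq_one_iff (x t : VGroup m) (k : ℕ) : radQuot m x t k = 1 ↔ t k = x k := by
  rw [radQuot_eq_toCircle, Circle.coe_eq_one, ← AddChar.map_zero_eq_one (ZMod.toCircle (N := m k)),
    ZMod.injective_toCircle.eq_iff, sub_eq_zero, eq_comm]

theorem radQuot_pow (x t : VGroup m) (k : ℕ) : radQuot m x t k ^ m k = 1 := by
  rw [radQuot_eq_toCircle, ← Circle.coe_pow, Circle.coe_eq_one, ← AddChar.map_nsmul_eq_pow]
  simp

theorem norm_psi (n : ℕ) (x : VGroup m) : ‖psi m n x‖ = 1 :=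
  norm_digitProd m (fun k => norm_rademacher m k x) n

theorem psi_mul_conj_psi (n : ℕ) (x t : VGroup m) :
    psi m n x * starRingEnd ℂ (psi m n t) = digitProd m (radQuot m x t) n := by
  rw [psi_eq_digitProd, psi_eq_digitProd, ← digitProd_conj, ← digitProd_mul]
  rfl

theorem mem_interval_comm {n : ℕ} {x y : VGroup m} : y ∈ interval m n x ↔ x ∈ interval m n y :=
  ⟨fun h k hk => (h k hk).symm, fun h k hk => (h k hk).symm⟩

theorem interval_anti (x : VGroup m) : Antitone fun n => interval m n x :=
  fun _ _ hab _ hy k hk => hy k (hk.trans_le hab)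

theorem interval_eq_of_mem {n : ℕ} {x y : VGroup m} (h : y ∈ interval m n x) :
    interval m n y = interval m n x := by
  ext z
  exact forall₂_congr fun k hk => by rw [h k hk]

theorem psi_congr {n N : ℕ} (hn : n < bigM m N) {x y : VGroup m} (h : y ∈ interval m N x) :
    psi m n y = psi m n x := by
  rw [psi_eq_digitProd, psi_eq_digitProd, digitProd_eq_prod_range m _ hn,
    digitProd_eq_prod_range m _ hn]
  refine Finset.prod_congr rfl fun k hk => ?_
  rw [rademacher_eq_toCircle, rademacher_eq_toCircle, h k (Finset.mem_range.1 hk)]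

theorem dirichlet_radQuot_bigM (x t : VGroup m) (k : ℕ) :
    dirichlet m (radQuot m x t) (bigM m k) = (interval m k x).indicator (fun _ => (bigM m k : ℂ)) t := by
  by_cases h : t ∈ interval m k x
  · rw [Set.indicator_of_mem h]
    exact dirichlet_bigM_of_eq_one m fun j hj => (radQuot_eq_one_iff m x t j).2 (h j hj)
  · rw [Set.indicator_of_notMem h]
    simp only [interval, Set.mem_ofPred_eq, not_forall] at h
    obtain ⟨j, hj, hne⟩ := h
    exact dirichlet_bigM_of_ne_one m hj (fun h1 => hne ((radQuot_eq_one_iff m x t j).1 h1))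
      (radQuot_pow m x t j)

/-- If `j < N` is the first coordinate where `t` and `x` differ, then `D_{M_{j+1}}` vanishes and the
kernel is at most `M_{j+1}`, with `t ∈ I_j(x)`. If there is none, the trivial bound `n ≤ M_N`
serves. Only one term of the sum is needed; the sum merely makes the bound integrable term by term.
-/
theorem enorm_dirichlet_radQuot_le (x t : VGroup m) {n N : ℕ} (hn : n ≤ bigM m N) :
    ‖dirichlet m (radQuot m x t) n‖ₑ ≤
      ∑ j ∈ Finset.range (N + 1),
        (interval m j x).indicator (fun _ => (bigM m (j + 1) : ENNReal)) t := by
  suffices h : ∃ j ∈ Finset.range (N + 1), t ∈ interval m j x ∧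
      ‖dirichlet m (radQuot m x t) n‖ ≤ bigM m (j + 1) by
    obtain ⟨j, hj, hmem, hle⟩ := h
    refine le_trans ?_ (Finset.single_le_sum (fun _ _ => zero_le) hj)
    rw [Set.indicator_of_mem hmem, ← ofReal_norm, ← ENNReal.ofReal_natCast]
    exact ENNReal.ofReal_le_ofReal hle
  by_cases h : t ∈ interval m N x
  · refine ⟨N, Finset.self_mem_range_succ N, h, ?_⟩
    refine (norm_dirichlet_le m (norm_radQuot m x t) n).trans ?_
    exact_mod_cast hn.trans ((bigM_strictMono m).monotone N.le_succ)
  · simp only [interval, Set.mem_ofPred_eq, not_forall] at h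
    classical
    have hex : ∃ j, j < N ∧ t j ≠ x j := by
      obtain ⟨j, hj, hne⟩ := h
      exact ⟨j, hj, hne⟩
    obtain ⟨hlt, hne⟩ := Nat.find_spec hex
    refine ⟨Nat.find hex, Finset.mem_range.2 (by omega), fun i hi => ?_, ?_⟩
    · by_contra hc
      exact Nat.find_min hex hi ⟨hi.trans hlt, hc⟩
    · refine norm_dirichlet_le_bigM m (norm_radQuot m x t) ?_ n
      exact dirichlet_bigM_of_ne_one m (Nat.lt_succ_self _)
        (fun h1 => hne ((radQuot_eq_one_iff m x t _).1 h1)) (radQuot_pow m x t _)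

end Characters

/-! ### Measure, filtration, Fourier coefficients and orthogonality -/

section Filtration

variable (m : ℕ → ℕ) [hm2 : ∀ k, (m k).AtLeastTwo]

instance : IsProbabilityMeasure (haar m) := by
  unfold haar; infer_instance

theorem haar_interval (n : ℕ) (x : VGroup m) :
    haar m (interval m n x) = (bigM m n : ENNReal)⁻¹ := by
  have h : interval m n x = Set.pi (Finset.range n : Set ℕ) (fun k => {x k}) := by
    ext y; simp [interval]
  rw [h, haar, Measure.infinitePi_pi _ (fun i _ => measurableSet_singleton _)]
  simp only [PMF.toMeasure_apply_singleton _ _ (measurableSet_singleton _),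
    PMF.uniformOfFintype_apply, ZMod.card]
  rw [bigM, Nat.cast_prod, ENNReal.prod_inv_distrib]
  intro i _ j _ _
  exact Or.inr (ENNReal.natCast_ne_top _)

theorem haar_real_interval (n : ℕ) (x : VGroup m) :
    (haar m).real (interval m n x) = (bigM m n : ℝ)⁻¹ := by
  simp [Measure.real, haar_interval]

theorem measurableSet_filt_interval (n : ℕ) (x : VGroup m) :
    MeasurableSet[filt m n] (interval m n x) :=
  MeasurableSpace.measurableSet_generateFrom ⟨x, rfl⟩

theorem mem_congr_of_measurableSet_filt {n : ℕ} {A : Set (VGroup m)} (hA : MeasurableSet[filt m n] A)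
    {x y : VGroup m} (h : y ∈ interval m n x) : x ∈ A ↔ y ∈ A := by
  induction A, hA using MeasurableSpace.generateFrom_induction with
  | hC t ht _ =>
    obtain ⟨z, rfl⟩ := ht
    rw [mem_interval_comm, mem_interval_comm m (x := z) (y := y), interval_eq_of_mem m h]
  | empty => simp
  | compl t _ ih => simp [ih]
  | iUnion s _ ih => simp only [Set.mem_iUnion, ih]

theorem measurableSet_filt_of_congr {n : ℕ} {A : Set (VGroup m)}
    (hA : ∀ x ∈ A, interval m n x ⊆ A) : MeasurableSet[filt m n] A := by
  -- `e` zeroes the coordinates from `n` on; its finite range represents all rank-`n` intervals, so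
  -- the union below is countable.
  let e : VGroup m → VGroup m := fun x k => if k < n then x k else 0
  have hfin : (Set.range e).Finite := by
    let g : ((k : Fin n) → ZMod (m k)) → VGroup m := fun v k => if h : k < n then v ⟨k, h⟩ else 0
    refine (Set.finite_range g).subset ?_
    rintro _ ⟨x, rfl⟩
    refine ⟨fun k => x k, ?_⟩
    funext k
    simp [g, e]
  have he : ∀ x, interval m n (e x) = interval m n x := fun x =>
    interval_eq_of_mem m fun k hk => by simp [e, hk]
  have hEq : A = ⋃ y ∈ e '' A, interval m n y := by
    ext y
    simp only [Set.mem_iUnion, Set.mem_image, exists_prop, exists_exists_and_eq_and, he]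
    exact ⟨fun hy => ⟨y, hy, fun _ _ => rfl⟩, fun ⟨x, hx, hy⟩ => hA x hx hy⟩
  rw [hEq]
  exact MeasurableSet.biUnion ((hfin.subset (Set.image_subset_range e A)).countable)
    fun y _ => measurableSet_filt_interval m n y

theorem stronglyMeasurable_filt_of_congr {n : ℕ} {f : VGroup m → ℂ}
    (hf : ∀ x, ∀ y ∈ interval m n x, f y = f x) : StronglyMeasurable[filt m n] f := by
  refine Measurable.stronglyMeasurable fun U _ => measurableSet_filt_of_congr m fun x hx y hy => ?_
  rw [Set.mem_preimage, hf x y hy]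
  exact hx

theorem congr_of_stronglyMeasurable_filt {n : ℕ} {f : VGroup m → ℂ}
    (hf : StronglyMeasurable[filt m n] f) {x y : VGroup m} (h : y ∈ interval m n x) : f y = f x :=
  (mem_congr_of_measurableSet_filt m (hf.measurable (measurableSet_singleton (f x))) h).1 rfl

theorem stronglyMeasurable_filt_psi {i n : ℕ} (h : i < bigM m n) :
    StronglyMeasurable[filt m n] (psi m i) :=
  stronglyMeasurable_filt_of_congr m fun _ _ hy => psi_congr m h hy

theorem stronglyMeasurable_psi (i : ℕ) : StronglyMeasurable (psi m i) :=
  (stronglyMeasurable_filt_psi m (lt_bigM_self m i)).mono ((filt m).le i)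

theorem integrable_mul_conj_psi {f : VGroup m → ℂ} (hf : Integrable f (haar m)) (i : ℕ) :
    Integrable (fun x => f x * starRingEnd ℂ (psi m i x)) (haar m) :=
  hf.mul_bdd (c := 1) (RCLike.continuous_conj.comp_stronglyMeasurable
    (stronglyMeasurable_psi m i)).aestronglyMeasurable (ae_of_all _ fun x => by simp [norm_psi])

/-- For `i < M_N` the character is `F_N`-measurable and pulls out of the conditional expectation.
The limit defining `coeff` is thus of an eventually constant sequence. -/
theorem integral_mul_conj_psi_of_martingale {f : ℕ → VGroup m → ℂ}
    (hf : Martingale f (filt m) (haar m)) {i N k : ℕ} (hi : i < bigM m N) (hk : N ≤ k) :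
    ∫ x, f k x * starRingEnd ℂ (psi m i x) ∂(haar m) =
      ∫ x, f N x * starRingEnd ℂ (psi m i x) ∂(haar m) := by
  have hs : StronglyMeasurable[filt m N] fun x => starRingEnd ℂ (psi m i x) :=
    RCLike.continuous_conj.comp_stronglyMeasurable (stronglyMeasurable_filt_psi m hi)
  have h1 := condExp_bilin_of_stronglyMeasurable_right (ContinuousLinearMap.mul ℝ ℂ)
    (μ := haar m) (f := f k) hs
    (integrable_mul_conj_psi m (hf.integrable k) i) (hf.integrable k)
  rw [← integral_condExp ((filt m).le N)]
  refine integral_congr_ae ?_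
  filter_upwards [h1, hf.2 N k hk] with x hx1 hx2
  rw [hx2] at hx1
  exact hx1

theorem coeff_eq_integral {f : ℕ → VGroup m → ℂ} (hf : Martingale f (filt m) (haar m)) {i N : ℕ}
    (hi : i < bigM m N) :
    coeff f i = ∫ x, f N x * starRingEnd ℂ (psi m i x) ∂(haar m) := by
  refine Tendsto.limUnder_eq (tendsto_const_nhds.congr' ?_)
  filter_upwards [eventually_ge_atTop N] with k hk
  exact (integral_mul_conj_psi_of_martingale m hf hi hk).symm

theorem sum_integral_mul_psi {g : VGroup m → ℂ} (hg : Integrable g (haar m)) (n : ℕ)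
    (x : VGroup m) :
    ∑ i ∈ Finset.range n, (∫ t, g t * starRingEnd ℂ (psi m i t) ∂(haar m)) * psi m i x =
      ∫ t, g t * dirichlet m (radQuot m x t) n ∂(haar m) := by
  simp_rw [← integral_mul_const]
  rw [← integral_finsetSum _ fun i _ => (integrable_mul_conj_psi m hg i).mul_const _]
  refine integral_congr_ae (ae_of_all _ fun t => ?_)
  simp only [dirichlet, Finset.mul_sum]
  refine Finset.sum_congr rfl fun i _ => ?_
  rw [← psi_mul_conj_psi]
  ring

theorem partialSum_eq_integral {f : ℕ → VGroup m → ℂ} (hf : Martingale f (filt m) (haar m))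
    {n N : ℕ} (hn : n ≤ bigM m N) (x : VGroup m) :
    partialSum n f x = ∫ t, f N t * dirichlet m (radQuot m x t) n ∂(haar m) := by
  rw [← sum_integral_mul_psi m (hf.integrable N), partialSum]
  refine Finset.sum_congr rfl fun i hi => ?_
  rw [coeff_eq_integral m hf ((Finset.mem_range.1 hi).trans_le hn)]

/-- The Fourier partial sums of order `M_N` reproduce the functions of the first `N`
coordinates. -/
theorem sum_integral_mul_psi_bigM {g : VGroup m → ℂ} (hg : Integrable g (haar m)) {N : ℕ}
    (hgm : StronglyMeasurable[filt m N] g) (x : VGroup m) :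
    ∑ i ∈ Finset.range (bigM m N),
      (∫ t, g t * starRingEnd ℂ (psi m i t) ∂(haar m)) * psi m i x = g x := by
  rw [sum_integral_mul_psi m hg]
  have h : ∀ t, g t * dirichlet m (radQuot m x t) (bigM m N) =
      (interval m N x).indicator (fun _ => g x * bigM m N) t := by
    intro t
    rw [dirichlet_radQuot_bigM]
    by_cases ht : t ∈ interval m N x
    · simp [ht, congr_of_stronglyMeasurable_filt m hgm ht]
    · simp [ht]
  simp_rw [h]
  rw [integral_indicator_const _ (measurableSet_interval m N x), haar_real_interval]
  have : (bigM m N : ℂ) ≠ 0 := by exact_mod_cast (bigM_pos m N).ne'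
  rw [Complex.real_smul]
  push_cast
  field_simp

theorem integrable_psi (i : ℕ) : Integrable (psi m i) (haar m) :=
  Integrable.of_bound (stronglyMeasurable_psi m i).aestronglyMeasurable 1
    (ae_of_all _ fun x => (norm_psi m i x).le)

theorem integral_psi_mul_conj_self (i : ℕ) :
    ∫ x, psi m i x * starRingEnd ℂ (psi m i x) ∂(haar m) = 1 := by
  simp [Complex.mul_conj, Complex.normSq_eq_norm_sq, norm_psi]

/-- Orthogonality follows from the reproducing formula: expand `ψ_i` in the system, pair with `ψ_i`,
and get `∑_k |A_k|² = 1`. Since `A_i = 1` already, every other `A_k` vanishes. -/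
theorem integral_psi_mul_conj_of_ne {i j : ℕ} (hij : i ≠ j) :
    ∫ x, psi m i x * starRingEnd ℂ (psi m j x) ∂(haar m) = 0 := by
  let A : ℕ → ℂ := fun k => ∫ x, psi m i x * starRingEnd ℂ (psi m k x) ∂(haar m)
  set N := max i j
  have hi : i < bigM m N := (le_max_left i j).trans_lt (lt_bigM_self m _)
  have hj : j < bigM m N := (le_max_right i j).trans_lt (lt_bigM_self m _)
  have hrep := sum_integral_mul_psi_bigM m (integrable_psi m i) (stronglyMeasurable_filt_psi m hi)
  have hconj : ∀ k, ∫ x, psi m k x * starRingEnd ℂ (psi m i x) ∂(haar m) = starRingEnd ℂ (A k) := by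
    intro k
    rw [← integral_conj]
    simp [mul_comm]
  have hsum : ∑ k ∈ Finset.range (bigM m N), A k * starRingEnd ℂ (A k) = 1 := by
    have hI : ∀ x, psi m i x * starRingEnd ℂ (psi m i x) =
        ∑ k ∈ Finset.range (bigM m N), A k * (psi m k x * starRingEnd ℂ (psi m i x)) := by
      intro x
      simp_rw [← mul_assoc, ← Finset.sum_mul]
      exact congrArg (· * starRingEnd ℂ (psi m i x)) (hrep x).symm
    rw [← integral_psi_mul_conj_self m i, integral_congr_ae (ae_of_all _ hI), integral_finsetSum]
    · simp_rw [integral_const_mul, hconj]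
    · exact fun k _ => (integrable_mul_conj_psi m (integrable_psi m k) i).const_mul _
  have hsum' : ∑ k ∈ Finset.range (bigM m N), Complex.normSq (A k) = 1 := by
    have := hsum
    simp_rw [Complex.mul_conj] at this
    exact_mod_cast this
  have hAi : Complex.normSq (A i) = 1 := by
    simp only [A, integral_psi_mul_conj_self, map_one]
  rw [← Finset.add_sum_erase _ _ (Finset.mem_range.2 hi), hAi, add_eq_left,
    Finset.sum_eq_zero_iff_of_nonneg fun _ _ => Complex.normSq_nonneg _] at hsum'
  exact Complex.normSq_eq_zero.1
    (hsum' j (Finset.mem_erase.2 ⟨hij.symm, Finset.mem_range.2 hj⟩))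

end Filtration

/-! ### Logarithmic means as convex averages -/

section LogarithmicMeans

theorem logWeight_eq_ofReal (n : ℕ) :
    logWeight n = ((∑ k ∈ Finset.range n, 1 / ((n : ℝ) - k) : ℝ) : ℂ) := by
  simp [logWeight]

theorem sum_one_div_sub_eq_harmonic (n : ℕ) :
    ∑ k ∈ Finset.range n, 1 / ((n : ℝ) - k) = harmonic n := by
  rw [harmonic, ← Finset.sum_range_reflect]
  push_cast
  refine Finset.sum_congr rfl fun k hk => ?_
  have hk := Finset.mem_range.1 hk
  rw [Nat.sub_sub, Nat.cast_sub (by omega), one_div]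
  congr 1
  push_cast
  ring

theorem norm_logWeight (n : ℕ) : ‖logWeight n‖ = harmonic n := by
  rw [logWeight_eq_ofReal, sum_one_div_sub_eq_harmonic, Complex.norm_real, Real.norm_of_nonneg]
  rcases n.eq_zero_or_pos with rfl | h
  · simp
  · exact_mod_cast (harmonic_pos h.ne').le

/-- The weights `1 / (l_n (n - k))` are positive and sum to one. -/
theorem norm_logMean_le (n : ℕ) (a : ℕ → ℂ) {A : ℝ} (hA : 0 ≤ A) (h : ∀ k < n, ‖a k‖ ≤ A) :
    ‖1 / logWeight n * ∑ k ∈ Finset.range n, a k / ((n : ℂ) - (k : ℂ))‖ ≤ A := by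
  rcases n.eq_zero_or_pos with rfl | hn
  · simpa using hA
  have hpos : (0 : ℝ) < harmonic n := by exact_mod_cast harmonic_pos hn.ne'
  rw [norm_mul, norm_div, norm_one, norm_logWeight, one_div, inv_mul_le_iff₀ hpos,
    ← sum_one_div_sub_eq_harmonic, Finset.sum_mul]
  refine (norm_sum_le _ _).trans (Finset.sum_le_sum fun k hk => ?_)
  have hk' := Finset.mem_range.1 hk
  have hpos : (0 : ℝ) < (n : ℝ) - k := by
    rw [sub_pos]; exact_mod_cast hk'
  have hn : ‖(n : ℂ) - (k : ℂ)‖ = (n : ℝ) - k := by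
    rw [show (n : ℂ) - (k : ℂ) = (((n : ℝ) - k : ℝ) : ℂ) by push_cast; rfl, Complex.norm_real,
      Real.norm_of_nonneg hpos.le]
  rw [norm_div, hn, div_eq_mul_one_div, mul_comm]
  gcongr
  exact h k hk'

theorem enorm_logMean_le (n : ℕ) (a : ℕ → ℂ) {A : ENNReal} (h : ∀ k < n, ‖a k‖ₑ ≤ A) :
    ‖1 / logWeight n * ∑ k ∈ Finset.range n, a k / ((n : ℂ) - (k : ℂ))‖ₑ ≤ A := by
  rcases eq_or_ne A ⊤ with rfl | hA
  · exact le_top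
  rw [← ofReal_norm]
  refine ENNReal.ofReal_le_of_le_toReal (norm_logMean_le n a ENNReal.toReal_nonneg fun k hk => ?_)
  rw [← toReal_enorm]
  exact ENNReal.toReal_mono hA (h k hk)

end LogarithmicMeans

theorem tsum_rpow_le_tsum_rpow {ι : Type*} (a : ι → ENNReal) {p : ℝ} (hp0 : 0 < p) (hp1 : p ≤ 1) :
    (∑' i, a i) ^ p ≤ ∑' i, a i ^ p := by
  have h : ∑' i, a i ≤ (∑' i, a i ^ p) ^ p⁻¹ := by
    refine ENNReal.summable.tsum_le_of_sum_le fun s => ?_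
    rw [ENNReal.le_rpow_inv_iff hp0]
    refine (Finset.le_sum_of_subadditive (fun y : ENNReal => y ^ p) (ENNReal.zero_rpow_of_pos hp0).le
      (fun x y => ENNReal.rpow_add_le_add_rpow x y hp0.le hp1) s a).trans ?_
    exact ENNReal.sum_le_tsum s
  exact (ENNReal.le_rpow_inv_iff hp0).1 h

/-! ### The maximal inequality -/

section MaximalInequality

variable (m : ℕ → ℕ) [hm2 : ∀ k, (m k).AtLeastTwo]

theorem lpQNorm_eq {p : ℝ} (hp0 : 0 < p) (F : VGroup m → ENNReal) :
    lpQNorm p F = (∫⁻ x, F x ^ p ∂(haar m)) ^ (1 / p) := by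
  rw [lpQNorm, eLpNorm_eq_lintegral_rpow_enorm_toReal (by simpa using hp0) ENNReal.ofReal_ne_top,
    ENNReal.toReal_ofReal hp0.le]
  simp

theorem measurable_martMax {f : ℕ → VGroup m → ℂ} (hf : Martingale f (filt m) (haar m)) :
    Measurable (martMax f) := by
  refine Measurable.iSup fun n => ?_
  exact ((hf.1 n).mono ((filt m).le n)).measurable.enorm

theorem measurableSet_mem_interval (j : ℕ) :
    MeasurableSet {q : VGroup m × VGroup m | q.2 ∈ interval m j q.1} := by
  have h : {q : VGroup m × VGroup m | q.2 ∈ interval m j q.1} =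
      ⋂ k ∈ Set.Iio j, {q : VGroup m × VGroup m | q.2 k = q.1 k} := by
    ext q; simp [interval]
  rw [h]
  refine MeasurableSet.biInter (Set.to_countable _) fun k _ => measurableSet_eq_fun ?_ ?_
  · exact (measurable_pi_apply (X := fun k => ZMod (m k)) k).comp measurable_snd
  · exact (measurable_pi_apply (X := fun k => ZMod (m k)) k).comp measurable_fst

theorem measurable_indicator_interval {h : VGroup m → ENNReal} (hh : Measurable h) (j : ℕ) :
    Measurable (Function.uncurry fun x t => (interval m j x).indicator h t) := by
  have h' : (Function.uncurry fun x t => (interval m j x).indicator h t) =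
      {q : VGroup m × VGroup m | q.2 ∈ interval m j q.1}.indicator (h ∘ Prod.snd) := by
    ext ⟨x, t⟩
    by_cases ht : t ∈ interval m j x <;> simp [ht]
  rw [h']
  exact (hh.comp measurable_snd).indicator (measurableSet_mem_interval m j)

theorem measurable_lintegral_interval {h : VGroup m → ENNReal} (hh : Measurable h) (j : ℕ) :
    Measurable fun x => ∫⁻ t in interval m j x, h t ∂(haar m) := by
  simp_rw [← lintegral_indicator (measurableSet_interval m j _)]
  exact (measurable_indicator_interval m hh j).lintegral_prod_right

/-- Tonelli, with the symmetry `t ∈ I_j(x) ↔ x ∈ I_j(t)`: each `t` is counted on a set of measure `1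
/ M_j`. -/
theorem lintegral_lintegral_interval {h : VGroup m → ENNReal} (hh : Measurable h) (j : ℕ) :
    ∫⁻ x, ∫⁻ t in interval m j x, h t ∂(haar m) ∂(haar m) =
      (bigM m j : ENNReal)⁻¹ * ∫⁻ t, h t ∂(haar m) := by
  simp_rw [← lintegral_indicator (measurableSet_interval m j _)]
  rw [lintegral_lintegral_swap (measurable_indicator_interval m hh j).aemeasurable,
    ← lintegral_const_mul _ hh]
  refine lintegral_congr fun t => ?_
  have : ∀ x, (interval m j x).indicator h t = (interval m j t).indicator (fun _ => h t) x := by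
    intro x
    by_cases hx : x ∈ interval m j t
    · simp [hx, (mem_interval_comm m).1 hx]
    · simp [hx, mt (mem_interval_comm m).1 hx]
  simp_rw [this]
  rw [lintegral_indicator_const (measurableSet_interval m j t), haar_interval, mul_comm]

/-- A Nikolskii-type inequality: `f` is constant on atoms of measure `1 / M_N`, so its value at one
point already forces `|f|^p ≤ M_N * A` on `I_j(x)`, and this sup bound upgrades `L_p` to `L_1`. -/
theorem lintegral_interval_le_rpow {p : ℝ} (hp0 : 0 < p) (hp1 : p < 1) {N j : ℕ} (hj : j ≤ N)
    {f : VGroup m → ℂ} (hf : StronglyMeasurable[filt m N] f) (x : VGroup m) :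
    ∫⁻ t in interval m j x, ‖f t‖ₑ ∂(haar m) ≤
      (bigM m N : ENNReal) ^ (1 / p - 1) *
        (∫⁻ t in interval m j x, ‖f t‖ₑ ^ p ∂(haar m)) ^ (1 / p) := by
  set A := ∫⁻ t in interval m j x, ‖f t‖ₑ ^ p ∂(haar m) with hA
  have hα : 0 ≤ 1 / p - 1 := by
    rw [sub_nonneg, le_div_iff₀ hp0]; linarith
  have hM0 : (bigM m N : ENNReal) ≠ 0 := by exact_mod_cast (bigM_pos m N).ne'
  have hMt : (bigM m N : ENNReal) ≠ ⊤ := ENNReal.natCast_ne_top _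
  have hmeas : Measurable fun t => ‖f t‖ₑ ^ p :=
    ((hf.mono ((filt m).le N)).measurable.enorm).pow_const p
  have hle : ∀ t ∈ interval m j x, ‖f t‖ₑ ^ p ≤ bigM m N * A := by
    intro t ht
    have hsub : interval m N t ⊆ interval m j x := by
      rw [← interval_eq_of_mem m ht]
      exact interval_anti m t hj
    have h1 : ∫⁻ s in interval m N t, ‖f s‖ₑ ^ p ∂(haar m) = ‖f t‖ₑ ^ p * (bigM m N : ENNReal)⁻¹ := by
      rw [setLIntegral_congr_fun (g := fun _ => ‖f t‖ₑ ^ p) (measurableSet_interval m N t)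
        fun s hs => by simp only [congr_of_stronglyMeasurable_filt m hf hs],
        setLIntegral_const, haar_interval]
    have h2 : ‖f t‖ₑ ^ p * (bigM m N : ENNReal)⁻¹ ≤ A := h1 ▸ lintegral_mono_set hsub
    rw [← div_eq_mul_inv] at h2
    rw [mul_comm]
    exact (ENNReal.div_le_iff hM0 hMt).1 h2
  have hpt : ∀ t ∈ interval m j x, ‖f t‖ₑ ≤ (bigM m N * A) ^ (1 / p - 1) * ‖f t‖ₑ ^ p := by
    intro t ht
    -- One factor `|f|^p` is kept for integration; the remaining power is estimated by `hle`.
    calc ‖f t‖ₑ = ‖f t‖ₑ ^ (p * (1 / p - 1) + p) := by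
          rw [show p * (1 / p - 1) + p = 1 by field_simp; ring, ENNReal.rpow_one]
      _ = (‖f t‖ₑ ^ p) ^ (1 / p - 1) * ‖f t‖ₑ ^ p := by
          rw [ENNReal.rpow_add_of_nonneg _ _ (by positivity) hp0.le, ENNReal.rpow_mul]
      _ ≤ _ := by gcongr; exact hle t ht
  calc ∫⁻ t in interval m j x, ‖f t‖ₑ ∂(haar m)
      ≤ ∫⁻ t in interval m j x, (bigM m N * A) ^ (1 / p - 1) * ‖f t‖ₑ ^ p ∂(haar m) :=
        setLIntegral_mono' (measurableSet_interval m j x) hpt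
    _ = (bigM m N * A) ^ (1 / p - 1) * A := lintegral_const_mul _ hmeas
    _ = (bigM m N : ENNReal) ^ (1 / p - 1) * A ^ (1 / p) := by
        rw [ENNReal.mul_rpow_of_nonneg _ _ hα, mul_assoc]
        congr 1
        conv_lhs => enter [2]; rw [← ENNReal.rpow_one A]
        rw [← ENNReal.rpow_add_of_nonneg _ _ hα zero_le_one, sub_add_cancel]

theorem enorm_partialSum_le_sum {f : ℕ → VGroup m → ℂ} (hf : Martingale f (filt m) (haar m))
    {n N : ℕ} (hn : n ≤ bigM m N) (x : VGroup m) :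
    ‖partialSum n f x‖ₑ ≤ ∑ j ∈ Finset.range (N + 1),
      (bigM m (j + 1) : ENNReal) * ∫⁻ t in interval m j x, ‖f N t‖ₑ ∂(haar m) := by
  have hmeas : Measurable fun t => ‖f N t‖ₑ := ((hf.1 N).mono ((filt m).le N)).measurable.enorm
  rw [partialSum_eq_integral m hf hn]
  calc ‖∫ t, f N t * dirichlet m (radQuot m x t) n ∂(haar m)‖ₑ
      ≤ ∫⁻ t, ‖f N t * dirichlet m (radQuot m x t) n‖ₑ ∂(haar m) :=
        enorm_integral_le_lintegral_enorm _
    _ ≤ ∫⁻ t, ∑ j ∈ Finset.range (N + 1), (interval m j x).indicator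
          (fun t => (bigM m (j + 1) : ENNReal) * ‖f N t‖ₑ) t ∂(haar m) := by
        refine lintegral_mono fun t => ?_
        rw [enorm_mul]
        refine (mul_le_mul_right (enorm_dirichlet_radQuot_le m x t hn) _).trans_eq ?_
        rw [Finset.mul_sum]
        refine Finset.sum_congr rfl fun j _ => ?_
        by_cases ht : t ∈ interval m j x <;> simp [ht, mul_comm]
    _ = _ := by
        rw [lintegral_finsetSum _ fun j _ =>
          (hmeas.const_mul _).indicator (measurableSet_interval m j x)]
        refine Finset.sum_congr rfl fun j _ => ?_
        rw [lintegral_indicator (measurableSet_interval m j x), lintegral_const_mul _ hmeas]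

/-- Boundedness of `m` enters here: the first `M_N ≥ n` overshoots by at most the factor `B`, so a
power of `M_N` can be exchanged for one of `n + 1`. -/
theorem exists_bigM_between {B : ℕ} (hB : ∀ k, m k ≤ B) (n : ℕ) :
    ∃ N, n ≤ bigM m N ∧ bigM m N ≤ B * (n + 1) := by
  have hex : ∃ N, n ≤ bigM m N := ⟨n, (lt_bigM_self m n).le⟩
  classical
  refine ⟨Nat.find hex, Nat.find_spec hex, ?_⟩
  have hB1 : 1 ≤ B := by have := (hm2 0).prop; have := hB 0; omega
  rcases h : Nat.find hex with _ | N
  · simpa [bigM] using Nat.mul_le_mul hB1 (Nat.succ_le_succ (Nat.zero_le n))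
  · have : bigM m N < n := by
      have := Nat.find_min hex (m := N) (by omega)
      omega
    rw [bigM_succ, mul_comm]
    exact Nat.mul_le_mul (hB N) (by omega)

/-- The majorant `∑_j M_j (∫_{I_j(x)} (f^*)^p)^{1/p}` of the weighted
partial sums. -/
def intervalMajorant (p : ℝ) (f : ℕ → VGroup m → ℂ) (x : VGroup m) : ENNReal :=
  ∑' j, (bigM m j : ENNReal) * (∫⁻ t in interval m j x, martMax f t ^ p ∂(haar m)) ^ (1 / p)

theorem enorm_partialSum_le {B : ℕ} (hB : ∀ k, m k ≤ B) {p : ℝ} (hp0 : 0 < p) (hp1 : p < 1)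
    {f : ℕ → VGroup m → ℂ} (hf : Martingale f (filt m) (haar m)) (n : ℕ) (x : VGroup m) :
    ‖partialSum n f x‖ₑ ≤
      ((n + 1 : ℕ) : ENNReal) ^ (1 / p - 1) * ((B : ENNReal) ^ (1 / p) * intervalMajorant m p f x) := by
  have hα : 0 ≤ 1 / p - 1 := by
    rw [sub_nonneg, le_div_iff₀ hp0]; linarith
  obtain ⟨N, hnN, hNn⟩ := exists_bigM_between m hB n
  calc ‖partialSum n f x‖ₑ
      ≤ ∑ j ∈ Finset.range (N + 1),
        (bigM m (j + 1) : ENNReal) * ∫⁻ t in interval m j x, ‖f N t‖ₑ ∂(haar m) :=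
        enorm_partialSum_le_sum m hf hnN x
    _ ≤ ∑ j ∈ Finset.range (N + 1), (bigM m N : ENNReal) ^ (1 / p - 1) * B *
        ((bigM m j : ENNReal) *
          (∫⁻ t in interval m j x, martMax f t ^ p ∂(haar m)) ^ (1 / p)) := by
        refine Finset.sum_le_sum fun j hj => ?_
        have h1 : (bigM m (j + 1) : ENNReal) ≤ B * bigM m j := by
          rw [bigM_succ, mul_comm]
          exact_mod_cast Nat.mul_le_mul_right _ (hB j)
        have h2 := lintegral_interval_le_rpow m hp0 hp1
          (Nat.lt_succ_iff.1 (Finset.mem_range.1 hj)) (hf.1 N) x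
        have h3 : ∫⁻ t in interval m j x, ‖f N t‖ₑ ^ p ∂(haar m) ≤
            ∫⁻ t in interval m j x, martMax f t ^ p ∂(haar m) := by
          refine lintegral_mono fun t => ENNReal.rpow_le_rpow ?_ hp0.le
          exact le_iSup (fun n => ‖f n t‖ₑ) N
        calc _ ≤ (B * bigM m j : ENNReal) * ((bigM m N : ENNReal) ^ (1 / p - 1) *
              (∫⁻ t in interval m j x, martMax f t ^ p ∂(haar m)) ^ (1 / p)) := by
              refine mul_le_mul' h1 (h2.trans ?_)
              gcongr
          _ = _ := by ring
    _ ≤ (bigM m N : ENNReal) ^ (1 / p - 1) * B * intervalMajorant m p f x := by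
        rw [← Finset.mul_sum]
        gcongr
        exact ENNReal.sum_le_tsum _
    _ ≤ ((B : ENNReal) * ((n + 1 : ℕ) : ENNReal)) ^ (1 / p - 1) * B * intervalMajorant m p f x := by
        gcongr
        exact_mod_cast hNn
    _ = _ := by
        rw [ENNReal.mul_rpow_of_nonneg _ _ hα]
        have : (B : ENNReal) ^ (1 / p) = (B : ENNReal) ^ (1 / p - 1) * B := by
          conv_rhs => enter [2]; rw [← ENNReal.rpow_one (B : ENNReal)]
          rw [← ENNReal.rpow_add_of_nonneg _ _ hα zero_le_one, sub_add_cancel]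
        rw [this]
        ring

theorem maxNorlundLog_rpow_le {B : ℕ} (hB : ∀ k, m k ≤ B) {p : ℝ} (hp0 : 0 < p) (hp1 : p < 1)
    {f : ℕ → VGroup m → ℂ} (hf : Martingale f (filt m) (haar m)) (x : VGroup m) :
    maxNorlundLog (fun n : ℕ+ => ((n : ℕ) : ℝ) ^ (1 / p - 1)) f x ≤
      (B : ENNReal) ^ (1 / p) * intervalMajorant m p f x := by
  have hα : 0 ≤ 1 / p - 1 := by
    rw [sub_nonneg, le_div_iff₀ hp0]; linarith
  refine iSup_le fun n => ?_
  have hw : ENNReal.ofReal (((n.succPNat : ℕ+) : ℕ) ^ (1 / p - 1) : ℝ) =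
      ((n + 1 : ℕ) : ENNReal) ^ (1 / p - 1) := by
    rw [← ENNReal.ofReal_rpow_of_nonneg (Nat.cast_nonneg _) hα, ENNReal.ofReal_natCast]
    rfl
  rw [hw]
  refine ENNReal.div_le_of_le_mul' (enorm_logMean_le n _ fun k hk => ?_)
  refine (enorm_partialSum_le m hB hp0 hp1 hf k x).trans ?_
  gcongr

theorem tsum_bigM_rpow_ne_top {p : ℝ} (hp1 : p < 1) : ∑' j, (bigM m j : ENNReal) ^ (p - 1) ≠ ⊤ := by
  have h2 : (2 : ENNReal) ^ (p - 1) < 1 :=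
    ENNReal.rpow_lt_one_of_one_lt_of_neg (by norm_num) (by linarith)
  refine ne_top_of_le_ne_top (b := ∑' j : ℕ, ((2 : ENNReal) ^ (p - 1)) ^ j) ?_
    (ENNReal.tsum_le_tsum fun j => ?_)
  · rw [ENNReal.tsum_geometric, ENNReal.inv_ne_top]
    exact (tsub_pos_of_lt h2).ne'
  · rw [← ENNReal.rpow_natCast, ← ENNReal.rpow_mul, mul_comm, ENNReal.rpow_mul,
      ENNReal.rpow_natCast]
    rw [← neg_sub 1 p, ENNReal.rpow_neg, ENNReal.rpow_neg, ENNReal.inv_le_inv]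
    refine ENNReal.rpow_le_rpow ?_ (by linarith)
    exact_mod_cast two_pow_le_bigM m j

theorem lintegral_intervalMajorant_rpow_le {p : ℝ} (hp0 : 0 < p) (hp1 : p < 1)
    {f : ℕ → VGroup m → ℂ} (hf : Martingale f (filt m) (haar m)) :
    ∫⁻ x, intervalMajorant m p f x ^ p ∂(haar m) ≤
      (∑' j, (bigM m j : ENNReal) ^ (p - 1)) * ∫⁻ x, martMax f x ^ p ∂(haar m) := by
  have hmeas : Measurable fun t => martMax f t ^ p := (measurable_martMax m hf).pow_const p
  calc ∫⁻ x, intervalMajorant m p f x ^ p ∂(haar m)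
      ≤ ∫⁻ x, ∑' j, (bigM m j : ENNReal) ^ p *
          ∫⁻ t in interval m j x, martMax f t ^ p ∂(haar m) ∂(haar m) := by
        refine lintegral_mono fun x => (tsum_rpow_le_tsum_rpow _ hp0 hp1.le).trans_eq ?_
        refine tsum_congr fun j => ?_
        rw [ENNReal.mul_rpow_of_nonneg _ _ hp0.le, ← ENNReal.rpow_mul, one_div_mul_cancel hp0.ne',
          ENNReal.rpow_one]
    _ = ∑' j, (bigM m j : ENNReal) ^ p *
          ((bigM m j : ENNReal)⁻¹ * ∫⁻ t, martMax f t ^ p ∂(haar m)) := by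
        rw [lintegral_tsum fun j =>
          ((measurable_lintegral_interval m hmeas j).const_mul _).aemeasurable]
        refine tsum_congr fun j => ?_
        rw [lintegral_const_mul _ (measurable_lintegral_interval m hmeas j),
          lintegral_lintegral_interval m hmeas]
    _ = _ := by
        rw [← ENNReal.tsum_mul_right]
        refine tsum_congr fun j => ?_
        have hM0 : (bigM m j : ENNReal) ≠ 0 := by exact_mod_cast (bigM_pos m j).ne'
        rw [← mul_assoc, ENNReal.rpow_sub _ _ hM0 (ENNReal.natCast_ne_top _), ENNReal.rpow_one,
          div_eq_mul_inv]

theorem boundedHpLp_maxNorlundLog_rpow (hm : BddAbove (Set.range m)) {p : ℝ} (hp0 : 0 < p)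
    (hp1 : p < 1) :
    BoundedHpLp (m := m) p (maxNorlundLog fun n : ℕ+ => ((n : ℕ) : ℝ) ^ (1 / p - 1)) := by
  obtain ⟨B, hB⟩ := hm
  have hB : ∀ k, m k ≤ B := fun k => hB ⟨k, rfl⟩
  set S := ∑' j, (bigM m j : ENNReal) ^ (p - 1)
  have hS : S ≠ ⊤ := tsum_bigM_rpow_ne_top m hp1
  have hip : 0 ≤ 1 / p := by positivity
  have hBt : (B : ENNReal) ^ (1 / p) ≠ ⊤ :=
    ENNReal.rpow_ne_top_of_nonneg hip (ENNReal.natCast_ne_top _)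
  have hC : (B : ENNReal) ^ (1 / p) * S ^ (1 / p) ≠ ⊤ :=
    ENNReal.mul_ne_top hBt (ENNReal.rpow_ne_top_of_nonneg hip hS)
  refine ⟨((B : ENNReal) ^ (1 / p) * S ^ (1 / p)).toNNReal, fun f hf => ?_⟩
  rw [ENNReal.coe_toNNReal hC, hpNorm, lpQNorm_eq m hp0, lpQNorm_eq m hp0]
  calc _ ≤ (∫⁻ x, ((B : ENNReal) ^ (1 / p) * intervalMajorant m p f x) ^ p ∂(haar m)) ^ (1 / p) := by
        gcongr with x
        exact maxNorlundLog_rpow_le m hB hp0 hp1 hf.1 x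
    _ = (B * ∫⁻ x, intervalMajorant m p f x ^ p ∂(haar m)) ^ (1 / p) := by
        simp_rw [ENNReal.mul_rpow_of_nonneg _ _ hp0.le]
        rw [lintegral_const_mul' _ _ (ENNReal.rpow_ne_top_of_nonneg hp0.le hBt),
          ← ENNReal.rpow_mul, one_div_mul_cancel hp0.ne', ENNReal.rpow_one]
    _ ≤ (B * (S * ∫⁻ x, martMax f x ^ p ∂(haar m))) ^ (1 / p) := by
        gcongr
        exact lintegral_intervalMajorant_rpow_le m hp0 hp1 hf.1
    _ = _ := by
        rw [ENNReal.mul_rpow_of_nonneg _ _ hip, ENNReal.mul_rpow_of_nonneg _ _ hip, mul_assoc]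

end MaximalInequality

/-! ### The block martingale and its logarithmic means -/

section LacunaryMartingale

variable (m : ℕ → ℕ) [hm2 : ∀ k, (m k).AtLeastTwo]

theorem psi_zero_right (i : ℕ) : psi m i 0 = 1 := by
  simp [psi, rademacher]

theorem sum_range_psi_bigM (k : ℕ) (x : VGroup m) :
    ∑ i ∈ Finset.range (bigM m k), psi m i x =
      (interval m k 0).indicator (fun _ => (bigM m k : ℂ)) x := by
  have h : ∑ i ∈ Finset.range (bigM m k), psi m i x = dirichlet m (radQuot m x 0) (bigM m k) := by
    refine Finset.sum_congr rfl fun i _ => ?_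
    rw [← psi_mul_conj_psi, psi_zero_right, map_one, mul_one]
  rw [h, dirichlet_radQuot_bigM]
  by_cases hx : x ∈ interval m k 0
  · simp [hx, (mem_interval_comm m).1 hx]
  · simp [hx, mt (mem_interval_comm m).1 hx]

/-- The indicator of `A` is a combination of `ψ_j` with `j < M_n`, all orthogonal to `ψ_i`. This
gives the martingale property of block sums. -/
theorem setIntegral_psi_eq_zero {n i : ℕ} (hi : bigM m n ≤ i) {A : Set (VGroup m)}
    (hA : MeasurableSet[filt m n] A) : ∫ x in A, psi m i x ∂(haar m) = 0 := by
  have hA' := (filt m).le n A hA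
  let g : VGroup m → ℂ := A.indicator fun _ => 1
  have hgm : StronglyMeasurable[filt m n] g := stronglyMeasurable_const.indicator hA
  have hg : Integrable g (haar m) := (integrable_const 1).indicator hA'
  have hrep := sum_integral_mul_psi_bigM m hg hgm
  have hpt : ∀ x, A.indicator (psi m i) x = ∑ j ∈ Finset.range (bigM m n),
      starRingEnd ℂ (∫ t, g t * starRingEnd ℂ (psi m j t) ∂(haar m)) *
        (psi m i x * starRingEnd ℂ (psi m j x)) := by
    intro x
    have h1 : A.indicator (psi m i) x = psi m i x * starRingEnd ℂ (g x) := by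
      by_cases hx : x ∈ A <;> simp [g, hx]
    rw [h1, ← hrep x, map_sum, Finset.mul_sum]
    refine Finset.sum_congr rfl fun j _ => ?_
    rw [map_mul]
    ring
  rw [← integral_indicator hA', integral_congr_ae (ae_of_all _ hpt), integral_finsetSum _ fun j _ =>
    (integrable_mul_conj_psi m (integrable_psi m i) j).const_mul _]
  refine Finset.sum_eq_zero fun j hj => ?_
  have := Finset.mem_range.1 hj
  rw [integral_const_mul, integral_psi_mul_conj_of_ne m (by omega), mul_zero]

/-- The block `D_{M_{s+1}} - D_{M_s}` of the Vilenkin system. -/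
def psiBlock (s : ℕ) (x : VGroup m) : ℂ :=
  ∑ i ∈ Finset.Ico (bigM m s) (bigM m (s + 1)), psi m i x

theorem integrable_psiBlock (s : ℕ) : Integrable (psiBlock m s) (haar m) :=
  integrable_finsetSum _ fun i _ => integrable_psi m i

/-- Off `I_s(0)` both kernels `D_{M_{s+1}}` and `D_{M_s}` vanish; on it, counting terms suffices. -/
theorem enorm_psiBlock_le (s : ℕ) (x : VGroup m) :
    ‖psiBlock m s x‖ₑ ≤ (interval m s 0).indicator (fun _ => (bigM m (s + 1) : ENNReal)) x := by
  by_cases hx : x ∈ interval m s 0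
  · rw [Set.indicator_of_mem hx, ← ofReal_norm, ← ENNReal.ofReal_natCast]
    refine ENNReal.ofReal_le_ofReal ((norm_sum_le _ _).trans ?_)
    simp [norm_psi]
  · have hx' : x ∉ interval m (s + 1) 0 := fun h => hx (interval_anti m 0 s.le_succ h)
    rw [psiBlock, Finset.sum_Ico_eq_sub _ ((bigM_strictMono m).monotone s.le_succ),
      sum_range_psi_bigM, sum_range_psi_bigM]
    simp [hx, hx']

/-- The martingale `f_n = ∑_{s < n} c_s (D_{M_{s+1}} - D_{M_s})`. -/
def blockMartingale (c : ℕ → ℝ) (n : ℕ) (x : VGroup m) : ℂ :=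
  ∑ s ∈ Finset.range n, (c s : ℂ) * psiBlock m s x

theorem integrable_blockMartingale (c : ℕ → ℝ) (n : ℕ) :
    Integrable (blockMartingale m c n) (haar m) :=
  integrable_finsetSum _ fun s _ => (integrable_psiBlock m s).const_mul _

theorem martingale_blockMartingale (c : ℕ → ℝ) :
    Martingale (blockMartingale m c) (filt m) (haar m) := by
  refine martingale_of_setIntegral_eq_succ (fun n => ?_) (integrable_blockMartingale m c) ?_
  · refine stronglyMeasurable_filt_of_congr m fun x y hy => ?_
    refine Finset.sum_congr rfl fun s hs => congrArg _ (Finset.sum_congr rfl fun i hi => ?_)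
    have h1 := (bigM_strictMono m).monotone (Nat.succ_le_of_lt (Finset.mem_range.1 hs))
    exact psi_congr m ((Finset.mem_Ico.1 hi).2.trans_le h1) hy
  · intro n A hA
    have h : ∀ x, blockMartingale m c (n + 1) x =
        blockMartingale m c n x + (c n : ℂ) * psiBlock m n x := fun x =>
      Finset.sum_range_succ _ _
    simp_rw [h]
    rw [integral_add (integrable_blockMartingale m c n).integrableOn
      ((integrable_psiBlock m n).const_mul _).integrableOn, integral_const_mul]
    have h0 : ∫ x in A, psiBlock m n x ∂(haar m) = 0 := by
      simp only [psiBlock]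
      rw [integral_finsetSum _ fun i _ => (integrable_psi m i).integrableOn]
      exact Finset.sum_eq_zero fun i hi =>
        setIntegral_psi_eq_zero m (Finset.mem_Ico.1 hi).1 hA
    rw [h0, mul_zero, add_zero]

theorem coeff_blockMartingale (c : ℕ → ℝ) {i n : ℕ} (hi : i < bigM m n) :
    coeff (blockMartingale m c) i = ∑ s ∈ Finset.range n,
      (c s : ℂ) * if i ∈ Finset.Ico (bigM m s) (bigM m (s + 1)) then 1 else 0 := by
  rw [coeff_eq_integral m (martingale_blockMartingale m c) hi]
  simp only [blockMartingale, Finset.sum_mul, mul_assoc]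
  rw [integral_finsetSum _ fun s _ =>
    (integrable_mul_conj_psi m (integrable_psiBlock m s) i).const_mul _]
  refine Finset.sum_congr rfl fun s _ => ?_
  rw [integral_const_mul]
  congr 1
  simp only [psiBlock, Finset.sum_mul]
  rw [integral_finsetSum _ fun j _ => integrable_mul_conj_psi m (integrable_psi m j) i,
    ← Finset.sum_ite_eq' _ i fun _ => (1 : ℂ)]
  refine Finset.sum_congr rfl fun j _ => ?_
  split_ifs with h
  · rw [h, integral_psi_mul_conj_self]
  · exact integral_psi_mul_conj_of_ne m h

theorem coeff_blockMartingale_bigM (c : ℕ → ℝ) (N : ℕ) :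
    coeff (blockMartingale m c) (bigM m N) = c N := by
  have hlt := bigM_strictMono m N.lt_succ_self
  rw [coeff_blockMartingale m c hlt, Finset.sum_range_succ,
    Finset.sum_eq_zero, if_pos (Finset.mem_Ico.2 ⟨le_rfl, hlt⟩), zero_add, mul_one]
  intro s hs
  rw [if_neg, mul_zero]
  intro h
  exact absurd ((bigM_strictMono m).monotone (Nat.succ_le_of_lt (Finset.mem_range.1 hs)))
    (not_le.2 (Finset.mem_Ico.1 h).2)

theorem sum_norm_coeff_blockMartingale_le {c : ℕ → ℝ} (hc : ∀ s, 0 ≤ c s) (N : ℕ) :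
    ∑ i ∈ Finset.range (bigM m N), ‖coeff (blockMartingale m c) i‖ ≤
      ∑ s ∈ Finset.range N, c s * bigM m (s + 1) := by
  calc _ ≤ ∑ i ∈ Finset.range (bigM m N), ∑ s ∈ Finset.range N,
        c s * if i ∈ Finset.Ico (bigM m s) (bigM m (s + 1)) then 1 else 0 := by
        refine Finset.sum_le_sum fun i hi => ?_
        rw [coeff_blockMartingale m c (Finset.mem_range.1 hi)]
        refine (norm_sum_le _ _).trans_eq (Finset.sum_congr rfl fun s _ => ?_)
        rw [norm_mul, Complex.norm_real, Real.norm_of_nonneg (hc s)]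
        split_ifs <;> simp
    _ ≤ _ := by
        rw [Finset.sum_comm]
        refine Finset.sum_le_sum fun s _ => ?_
        rw [← Finset.mul_sum]
        refine mul_le_mul_of_nonneg_left ?_ (hc s)
        rw [Finset.sum_boole]
        have : ((Finset.range (bigM m N)).filter
            (· ∈ Finset.Ico (bigM m s) (bigM m (s + 1)))).card ≤ bigM m (s + 1) := by
          refine (Finset.card_le_card (t := Finset.range (bigM m (s + 1))) fun i hi => ?_).trans_eq
            (Finset.card_range _)
          exact Finset.mem_range.2 (Finset.mem_Ico.1 (Finset.mem_filter.1 hi).2).2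
        exact_mod_cast this

theorem norm_partialSum_le (f : ℕ → VGroup m → ℂ) {n K : ℕ} (h : n ≤ K) (x : VGroup m) :
    ‖partialSum n f x‖ ≤ ∑ i ∈ Finset.range K, ‖coeff f i‖ := by
  refine (norm_sum_le _ _).trans ?_
  simp only [norm_mul, norm_psi, mul_one]
  exact Finset.sum_le_sum_of_subset_of_nonneg (Finset.range_mono h) fun _ _ _ => norm_nonneg _

/-- The logarithmic mean of order `K + 2` isolates the coefficient of index `K`, because the last
partial sum carries the full weight `1 / l_{K+2}`. -/
theorem norm_coeff_div_harmonic_le (f : ℕ → VGroup m → ℂ) (K : ℕ) (x : VGroup m) :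
    ‖coeff f K‖ / harmonic (K + 2) ≤
      ‖norlundLog (K + 2) f x‖ + ∑ i ∈ Finset.range K, ‖coeff f i‖ := by
  -- Freezing the partial sums at order `K` changes only the term `k = K + 1`, whose denominator is
  -- `1`; the frozen mean involves only coefficients of index `< K`.
  let a : ℕ → ℂ := fun k => partialSum (min k K) f x
  have hmean := norm_logMean_le (K + 2) a (Finset.sum_nonneg fun i _ => norm_nonneg (coeff f i))
    fun k _ => norm_partialSum_le m f (min_le_right k K) x
  have hsplit : norlundLog (K + 2) f x =
      1 / logWeight (K + 2) * ∑ k ∈ Finset.range (K + 2), a k / (((K + 2 : ℕ) : ℂ) - (k : ℂ)) +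
        1 / logWeight (K + 2) * (coeff f K * psi m K x) := by
    rw [norlundLog, ← mul_add]
    congr 1
    have h1 : ((K + 2 : ℕ) : ℂ) - ((K + 1 : ℕ) : ℂ) = 1 := by push_cast; ring
    have h2 : ∑ k ∈ Finset.range (K + 1), partialSum k f x / (((K + 2 : ℕ) : ℂ) - (k : ℂ)) =
        ∑ k ∈ Finset.range (K + 1), a k / (((K + 2 : ℕ) : ℂ) - (k : ℂ)) := by
      refine Finset.sum_congr rfl fun k hk => ?_
      simp only [a]
      rw [min_eq_left (Nat.lt_succ_iff.1 (Finset.mem_range.1 hk))]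
    have h3 : partialSum (K + 1) f x = a (K + 1) + coeff f K * psi m K x := by
      simp only [a]
      rw [min_eq_right K.le_succ, partialSum, Finset.sum_range_succ, partialSum]
    rw [Finset.sum_range_succ _ (K + 1), Finset.sum_range_succ _ (K + 1), h2, h1, h3, div_one,
      div_one, add_assoc]
  have heq : ‖1 / logWeight (K + 2) * (coeff f K * psi m K x)‖ =
      ‖coeff f K‖ / harmonic (K + 2) := by
    rw [norm_mul, norm_mul, norm_psi, mul_one, norm_div, norm_one, norm_logWeight, one_div,
      inv_mul_eq_div]
  rw [← heq, eq_sub_of_add_eq' hsplit.symm]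
  exact (norm_sub_le _ _).trans (add_le_add_right hmean _)

/-- The maximal function is dominated by the sum of the block bounds, of height `c_s M_{s+1}` on a
set of measure `1 / M_s`. By `p`-subadditivity the `p`-th power integrals just add up. -/
theorem hpNorm_blockMartingale_lt_top {B : ℕ} (hB : ∀ k, m k ≤ B) {p : ℝ} (hp0 : 0 < p)
    (hp1 : p < 1) {c : ℕ → ℝ} (hc : ∀ s, 0 ≤ c s)
    (hsum : ∑' s, ENNReal.ofReal (c s) ^ p * (bigM m s : ENNReal) ^ (p - 1) ≠ ⊤) :
    hpNorm p (blockMartingale m c) < ⊤ := by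
  let u : ℕ → VGroup m → ENNReal := fun s =>
    (interval m s 0).indicator fun _ => ENNReal.ofReal (c s) * bigM m (s + 1)
  have hu : ∀ s, Measurable (u s) := fun s =>
    measurable_const.indicator (measurableSet_interval m s 0)
  have hmax : ∀ x, martMax (blockMartingale m c) x ≤ ∑' s, u s x := by
    refine fun x => iSup_le fun n => (enorm_sum_le _ _).trans ?_
    refine (Finset.sum_le_sum fun s _ => ?_).trans (ENNReal.sum_le_tsum (Finset.range n))
    rw [enorm_mul, ← ofReal_norm (c s : ℂ), Complex.norm_real, Real.norm_of_nonneg (hc s)]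
    refine (mul_le_mul_right (enorm_psiBlock_le m s x) _).trans_eq ?_
    by_cases hx : x ∈ interval m s 0 <;> simp [u, hx]
  have hterm : ∀ s, ∫⁻ x, u s x ^ p ∂(haar m) ≤
      (B : ENNReal) ^ p * (ENNReal.ofReal (c s) ^ p * (bigM m s : ENNReal) ^ (p - 1)) := by
    intro s
    have hM0 : (bigM m s : ENNReal) ≠ 0 := by exact_mod_cast (bigM_pos m s).ne'
    have h1 : ∀ x, u s x ^ p = (interval m s 0).indicator
        (fun _ => (ENNReal.ofReal (c s) * bigM m (s + 1)) ^ p) x := by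
      intro x
      by_cases hx : x ∈ interval m s 0 <;> simp [u, hx, hp0]
    simp_rw [h1]
    rw [lintegral_indicator_const (measurableSet_interval m s 0), haar_interval,
      ENNReal.rpow_sub _ _ hM0 (ENNReal.natCast_ne_top _), ENNReal.rpow_one, div_eq_mul_inv]
    calc _ ≤ (ENNReal.ofReal (c s) * (B * bigM m s)) ^ p * (bigM m s : ENNReal)⁻¹ := by
          gcongr
          rw [bigM_succ, mul_comm]
          exact_mod_cast Nat.mul_le_mul_right _ (hB s)
      _ = _ := by
          rw [ENNReal.mul_rpow_of_nonneg _ _ hp0.le, ENNReal.mul_rpow_of_nonneg _ _ hp0.le]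
          ring
  rw [hpNorm, lpQNorm_eq m hp0]
  refine ENNReal.rpow_lt_top_of_nonneg (by positivity) (ne_top_of_le_ne_top
    (b := ∑' s, (B : ENNReal) ^ p *
      (ENNReal.ofReal (c s) ^ p * (bigM m s : ENNReal) ^ (p - 1))) ?_ ?_)
  · rw [ENNReal.tsum_mul_left]
    exact ENNReal.mul_ne_top
      (ENNReal.rpow_ne_top_of_nonneg hp0.le (ENNReal.natCast_ne_top _)) hsum
  · calc _ ≤ ∫⁻ x, ∑' s, u s x ^ p ∂(haar m) := lintegral_mono fun x =>
          (ENNReal.rpow_le_rpow (hmax x) hp0.le).trans (tsum_rpow_le_tsum_rpow _ hp0 hp1.le)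
      _ = ∑' s, ∫⁻ x, u s x ^ p ∂(haar m) :=
          lintegral_tsum fun s => ((hu s).pow_const p).aemeasurable
      _ ≤ _ := ENNReal.tsum_le_tsum hterm

theorem lpQNorm_top {p : ℝ} (hp0 : 0 < p) : lpQNorm (m := m) p (fun _ => ⊤) = ⊤ := by
  rw [lpQNorm_eq m hp0]
  simp [hp0]

theorem maxNorlundLog_blockMartingale_eq_top {φ : ℕ+ → ℝ} (hφ : ∀ n, 1 ≤ φ n) {c : ℕ → ℝ}
    (hc : ∀ s, 0 ≤ c s)
    (hlarge : ∀ K : ℕ, ∃ N, harmonic (bigM m N + 2) *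
      (K * φ (bigM m N + 2).succPNat + ∑ s ∈ Finset.range N, c s * bigM m (s + 1)) ≤ c N)
    (x : VGroup m) : maxNorlundLog φ (blockMartingale m c) x = ⊤ := by
  refine ENNReal.eq_top_of_forall_nnreal_le fun r => ?_
  obtain ⟨K, hK⟩ := exists_nat_ge r
  obtain ⟨N, hN⟩ := hlarge K
  have hφ0 : 0 < φ (bigM m N + 2).succPNat := zero_lt_one.trans_le (hφ _)
  refine le_trans ?_ (le_iSup (fun n => ‖norlundLog n (blockMartingale m c) x‖ₑ /
    ENNReal.ofReal (φ n.succPNat)) (bigM m N + 2))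
  rw [ENNReal.le_div_iff_mul_le (Or.inl (by simpa using hφ0)) (Or.inl ENNReal.ofReal_ne_top)]
  calc (r : ENNReal) * ENNReal.ofReal (φ (bigM m N + 2).succPNat)
      ≤ (K : ENNReal) * ENNReal.ofReal (φ (bigM m N + 2).succPNat) := by
        gcongr
        exact_mod_cast hK
    _ = ENNReal.ofReal (K * φ (bigM m N + 2).succPNat) := by
        rw [ENNReal.ofReal_mul (Nat.cast_nonneg _), ENNReal.ofReal_natCast]
    _ ≤ ‖norlundLog (bigM m N + 2) (blockMartingale m c) x‖ₑ := by
        rw [← ofReal_norm]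
        refine ENNReal.ofReal_le_ofReal ?_
        have h1 := norm_coeff_div_harmonic_le m (blockMartingale m c) (bigM m N) x
        have h2 := sum_norm_coeff_blockMartingale_le m hc N
        have hh : (0 : ℝ) < harmonic (bigM m N + 2) := by
          exact_mod_cast harmonic_pos (by omega)
        rw [coeff_blockMartingale_bigM, Complex.norm_real, Real.norm_of_nonneg (hc N)] at h1
        rw [mul_comm, ← le_div_iff₀ hh] at hN
        linarith

end LacunaryMartingale

/-! ### Choice of the sparse coefficients -/

section Coefficients

variable (m : ℕ → ℕ) [hm2 : ∀ k, (m k).AtLeastTwo]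

theorem exists_bigM_le_lt (n : ℕ) (hn : 1 ≤ n) : ∃ k, bigM m k ≤ n ∧ n < bigM m (k + 1) := by
  classical
  have hex : ∃ k, n < bigM m k := ⟨n, lt_bigM_self m n⟩
  rcases h : Nat.find hex with _ | k
  · have := Nat.find_spec hex
    rw [h] at this
    simp [bigM] at this
    omega
  · refine ⟨k, ?_, ?_⟩
    · have := Nat.find_min hex (m := k) (by omega)
      omega
    · rw [← h]
      exact Nat.find_spec hex

/-- Transfers growth along arbitrary `n` to growth along `M_N`: with `M_{N+1} ≤ n < M_{N+2}`, going
down to `M_N` costs at most `B²` in size, while leaving room for `M_N + 3 ≤ n` so that monotonicity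
of `φ` applies. -/
theorem exists_le_bigM_rpow_div {B : ℕ} (hB : ∀ k, m k ≤ B) {α : ℝ} (hα : 0 ≤ α) {φ : ℕ+ → ℝ}
    (hφ : ∀ n, 1 ≤ φ n) (hmono : Monotone φ)
    (hlim : limsup (fun n : ℕ+ =>
      ((((n : ℕ) : ℝ) ^ α / (Real.log ((n : ℕ) : ℝ) * φ n) : ℝ) : EReal)) atTop = ⊤)
    (K : ℝ) (N₀ : ℕ) :
    ∃ N > N₀, K * (harmonic (bigM m N + 2) * φ (bigM m N + 2).succPNat) ≤
      (bigM m N : ℝ) ^ α := by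
  wlog hK : 0 ≤ K generalizing K
  · obtain ⟨N, hN, h⟩ := this 0 le_rfl
    refine ⟨N, hN, le_trans ?_ h⟩
    have h1 : (0 : ℝ) ≤ harmonic (bigM m N + 2) := by
      exact_mod_cast (harmonic_pos (by omega)).le
    have h2 := (zero_le_one.trans (hφ (bigM m N + 2).succPNat))
    nlinarith [mul_nonneg h1 h2]
  set C : ℝ := ((B : ℝ) * B) ^ α with hC
  have hfreq : ∃ᶠ n : ℕ+ in atTop,
      ((C * (3 * K) : ℝ) : EReal) <
        ((((n : ℕ) : ℝ) ^ α / (Real.log ((n : ℕ) : ℝ) * φ n) : ℝ) : EReal) :=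
    frequently_lt_of_lt_limsup (by isBoundedDefault) (hlim ▸ EReal.coe_lt_top _)
  -- The offset `4` gives `N ≥ N₀ + 3`, hence `N > N₀` and `M_N ≥ 4`.
  obtain ⟨n, hn, hlt⟩ := frequently_atTop.1 hfreq ⟨bigM m (N₀ + 4), bigM_pos m _⟩
  rw [EReal.coe_lt_coe_iff] at hlt
  have hn' : bigM m (N₀ + 4) ≤ n := hn
  obtain ⟨k, hk1, hk2⟩ := exists_bigM_le_lt m n n.pos
  have hk : N₀ + 4 ≤ k := by
    have := (bigM_strictMono m).lt_iff_lt.1 (hn'.trans_lt hk2)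
    omega
  obtain ⟨N, rfl⟩ : ∃ N, k = N + 1 := ⟨k - 1, by omega⟩
  refine ⟨N, by omega, ?_⟩
  have hM3 : bigM m N + 3 ≤ n := by
    have h1 : 3 ≤ bigM m N := by
      refine le_trans ?_ (two_pow_le_bigM m N)
      calc 3 ≤ 2 ^ 2 := by norm_num
        _ ≤ 2 ^ N := Nat.pow_le_pow_right (by norm_num) (by omega)
    have h2 := (hm2 N).prop
    rw [bigM_succ] at hk1
    nlinarith
  have hn3 : (3 : ℝ) ≤ (n : ℕ) := by exact_mod_cast (show 3 ≤ (n : ℕ) by omega)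
  have hφn : φ (bigM m N + 2).succPNat ≤ φ n := hmono (show (bigM m N + 2).succPNat ≤ n from hM3)
  have hlog1 : 1 ≤ Real.log (n : ℕ) := by
    rw [Real.le_log_iff_exp_le (by linarith)]
    exact (Real.exp_one_lt_d9.le.trans (by norm_num)).trans hn3
  -- Uses `1 + log (M_N + 2) ≤ 2 log n`, valid since `n ≥ 3 > e`; the constant `3` leaves slack.
  have hharm : (harmonic (bigM m N + 2) : ℝ) ≤ 3 * Real.log (n : ℕ) := by
    refine (harmonic_le_one_add_log _).trans ?_
    have : Real.log ((bigM m N + 2 : ℕ) : ℝ) ≤ Real.log (n : ℕ) :=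
      Real.log_le_log (by positivity) (by exact_mod_cast (by omega))
    linarith
  have hB0 : (0 : ℝ) < (B : ℝ) * B := by
    have : 0 < B := by have := (hm2 0).prop; have := hB 0; omega
    positivity
  have hnα : ((n : ℕ) : ℝ) ^ α ≤ C * (bigM m N : ℝ) ^ α := by
    rw [hC, ← Real.mul_rpow hB0.le (Nat.cast_nonneg _)]
    refine Real.rpow_le_rpow (Nat.cast_nonneg _) ?_ hα
    have h1 : bigM m (N + 1 + 1) ≤ B * B * bigM m N := by
      rw [bigM_succ, bigM_succ]
      calc bigM m N * m N * m (N + 1) ≤ bigM m N * B * B :=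
            Nat.mul_le_mul (Nat.mul_le_mul_left _ (hB N)) (hB (N + 1))
        _ = _ := by ring
    exact_mod_cast hk2.le.trans h1
  have hC0 : 0 < C := Real.rpow_pos_of_pos hB0 α
  have hφ0 : 0 < φ n := zero_lt_one.trans_le (hφ n)
  rw [lt_div_iff₀ (mul_pos (by linarith) hφ0)] at hlt
  have h1 : K * (harmonic (bigM m N + 2) * φ (bigM m N + 2).succPNat) ≤
      K * (3 * Real.log (n : ℕ) * φ n) := by
    refine mul_le_mul_of_nonneg_left ?_ hK
    exact mul_le_mul hharm hφn (zero_le_one.trans (hφ _)) (by linarith)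
  refine h1.trans (le_of_mul_le_mul_left ?_ hC0)
  linarith

theorem exists_blockCoefficients {p : ℝ} (hp0 : 0 < p) {φ : ℕ+ → ℝ}
    (hφ : ∀ n, 1 ≤ φ n)
    (hlarge : ∀ (K : ℝ) (N₀ : ℕ), ∃ N > N₀,
      K * (harmonic (bigM m N + 2) * φ (bigM m N + 2).succPNat) ≤ (bigM m N : ℝ) ^ (1 / p - 1)) :
    ∃ c : ℕ → ℝ, (∀ s, 0 ≤ c s) ∧
      ∑' s, ENNReal.ofReal (c s) ^ p * (bigM m s : ENNReal) ^ (p - 1) ≠ ⊤ ∧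
      ∀ K : ℕ, ∃ N, harmonic (bigM m N + 2) *
        (K * φ (bigM m N + 2).succPNat + ∑ s ∈ Finset.range N, c s * bigM m (s + 1)) ≤ c N := by
  set α := 1 / p - 1 with hαdef
  -- An a priori bound on the mass of all blocks up to `n`, valid for any `c_s ≤ M_s^α`; it lets `N`
  -- be chosen before `c` without circularity.
  let A : ℕ → ℝ := fun n => ∑ s ∈ Finset.range (n + 1), (bigM m s : ℝ) ^ α * bigM m (s + 1)
  have hA : ∀ n, 0 ≤ A n := fun n => Finset.sum_nonneg fun s _ => by positivity
  -- The factor `2^(k+1)` pays in advance for the damping `2^{-(k+1)}` of the next coefficient.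
  choose g hg1 hg2 using fun (k n : ℕ) => hlarge (2 ^ (k + 1) * (k + A n)) n
  let N : ℕ → ℕ := fun k => Nat.rec 0 g k
  have hNs : ∀ k, N (k + 1) = g k (N k) := fun _ => rfl
  have hN : StrictMono N := strictMono_nat_of_lt_succ fun k => hg1 k (N k)
  let b : ℕ → ℝ := fun k => (1 / 2) ^ k * (bigM m (N k) : ℝ) ^ α
  have hb : ∀ k, 0 ≤ b k := fun k => by positivity
  let c : ℕ → ℝ := Function.extend N b 0
  have hcN : ∀ k, c (N k) = b k := fun k => hN.injective.extend_apply _ _ _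
  have hc0 : ∀ s, s ∉ Set.range N → c s = 0 := fun s hs =>
    Function.extend_apply' _ _ _ hs
  have hc : ∀ s, 0 ≤ c s := by
    intro s
    by_cases hs : s ∈ Set.range N
    · obtain ⟨k, rfl⟩ := hs
      exact hcN k ▸ hb k
    · exact (hc0 s hs).ge
  have hcle : ∀ s, c s ≤ (bigM m s : ℝ) ^ α := by
    intro s
    by_cases hs : s ∈ Set.range N
    · obtain ⟨k, rfl⟩ := hs
      rw [hcN]
      exact mul_le_of_le_one_left (by positivity) (pow_le_one₀ (by norm_num) (by norm_num))
    · rw [hc0 s hs]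
      positivity
  refine ⟨c, hc, ?_, fun K => ⟨N (K + 1), ?_⟩⟩
  · rw [← hN.injective.tsum_eq]
    · have hterm : ∀ k, ENNReal.ofReal (c (N k)) ^ p * (bigM m (N k) : ENNReal) ^ (p - 1) =
          (ENNReal.ofReal (1 / 2) ^ p) ^ k := by
        intro k
        have hMpos : (0 : ℝ) < bigM m (N k) := by exact_mod_cast bigM_pos m (N k)
        rw [hcN, ← ENNReal.ofReal_natCast (bigM m (N k)), ENNReal.ofReal_rpow_of_pos hMpos,
          ENNReal.ofReal_rpow_of_nonneg (hb k) hp0.le, ← ENNReal.ofReal_mul (by positivity),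
          ENNReal.ofReal_rpow_of_pos (by norm_num), ← ENNReal.ofReal_pow (by positivity)]
        congr 1
        rw [Real.mul_rpow (by positivity) (by positivity), ← Real.rpow_mul hMpos.le, mul_assoc,
          -- Since `α p = 1 - p`, the powers of `M_{N_k}` cancel and leave the geometric term
          -- `2^{-kp}`.
          ← Real.rpow_add hMpos, show α * p + (p - 1) = 0 by rw [hαdef]; field_simp; ring,
          Real.rpow_zero, mul_one, ← Real.rpow_natCast, ← Real.rpow_natCast,
          ← Real.rpow_mul (by norm_num), ← Real.rpow_mul (by norm_num), mul_comm]
      simp_rw [hterm]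
      rw [ENNReal.tsum_geometric, ENNReal.inv_ne_top]
      refine (tsub_pos_of_lt (ENNReal.rpow_lt_one ?_ hp0)).ne'
      rw [ENNReal.ofReal_lt_one]
      norm_num
    · intro s hs
      by_contra hs'
      simp [hc0 s hs', hp0] at hs
  · have hsum : ∑ s ∈ Finset.range (N (K + 1)), c s * bigM m (s + 1) ≤ A (N K) := by
      have hsub : Finset.range (N K + 1) ⊆ Finset.range (N (K + 1)) :=
        Finset.range_mono (hN K.lt_succ_self)
      rw [← Finset.sum_subset hsub]
      · exact Finset.sum_le_sum fun s _ => mul_le_mul_of_nonneg_right (hcle s) (Nat.cast_nonneg _)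
      · intro s hs1 hs2
        rw [hc0, zero_mul]
        rintro ⟨k, rfl⟩
        have h1 := (hN.lt_iff_lt (a := k) (b := K + 1)).1 (Finset.mem_range.1 hs1)
        rw [Finset.mem_range, Nat.lt_succ_iff] at hs2
        exact hs2 (hN.monotone (Nat.lt_succ_iff.1 h1))
    have h := hg2 K (N K)
    rw [← hNs] at h
    set h' : ℝ := (harmonic (bigM m (N (K + 1)) + 2) : ℝ) with hh'
    set w := φ (bigM m (N (K + 1)) + 2).succPNat with hw
    have hh0 : 0 ≤ h' := by
      rw [hh']; exact_mod_cast (harmonic_pos (by omega)).le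
    have hw1 : 1 ≤ w := hφ _
    calc h' * (K * w + ∑ s ∈ Finset.range (N (K + 1)), c s * bigM m (s + 1))
        ≤ h' * (K * w + A (N K) * w) := by
          refine mul_le_mul_of_nonneg_left (add_le_add_right (hsum.trans ?_) _) hh0
          -- `φ ≥ 1` lets the earlier mass be absorbed into a multiple of the weight.
          exact le_mul_of_one_le_right (hA _) hw1
      _ = (1 / 2) ^ (K + 1) * (2 ^ (K + 1) * (K + A (N K)) * (h' * w)) := by
          have : (1 / 2 : ℝ) ^ (K + 1) * 2 ^ (K + 1) = 1 := by rw [← mul_pow]; norm_num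
          linear_combination (-(h' * w * (K + A (N K)))) * this
      _ ≤ (1 / 2) ^ (K + 1) * (bigM m (N (K + 1)) : ℝ) ^ α :=
          mul_le_mul_of_nonneg_left h (by positivity)
      _ = c (N (K + 1)) := (hcN _).symm

end Coefficients

theorem exists_hardy_maxNorlundLog_eq_top (m : ℕ → ℕ) [∀ k, (m k).AtLeastTwo]
    (hm : BddAbove (Set.range m)) {p : ℝ} (hp0 : 0 < p) (hp1 : p < 1) {φ : ℕ+ → ℝ}
    (hφ : ∀ n, 1 ≤ φ n) (hmono : Monotone φ)
    (hlim : limsup (fun n : ℕ+ =>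
      ((((n : ℕ) : ℝ) ^ (1 / p - 1) / (Real.log ((n : ℕ) : ℝ) * φ n) : ℝ) : EReal)) atTop = ⊤) :
    ∃ f ∈ HardySpace m p, lpQNorm p (maxNorlundLog φ f) = ⊤ := by
  obtain ⟨B, hB⟩ := hm
  have hB : ∀ k, m k ≤ B := fun k => hB ⟨k, rfl⟩
  have hα : 0 ≤ 1 / p - 1 := by
    rw [sub_nonneg, le_div_iff₀ hp0]; linarith
  obtain ⟨c, hc, hsum, hlarge⟩ := exists_blockCoefficients m hp0 hφ
    (exists_le_bigM_rpow_div m hB hα hφ hmono hlim)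
  refine ⟨blockMartingale m c, ⟨martingale_blockMartingale m c,
    hpNorm_blockMartingale_lt_top m hB hp0 hp1 hc hsum⟩, ?_⟩
  rw [funext (maxNorlundLog_blockMartingale_eq_top m hφ hc hlarge), lpQNorm_top m hp0]

end Vilenkin

end

theorem theorem1 (m : ℕ → ℕ) [∀ k, (m k).AtLeastTwo] (hm : BddAbove (Set.range m))
    (p : ℝ) (hp0 : 0 < p) (hp1 : p < 1) :
    Vilenkin.BoundedHpLp (m := m) p
        (Vilenkin.maxNorlundLog fun n : ℕ+ => ((n : ℕ) : ℝ) ^ (1 / p - 1)) ∧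
      ∀ φ : ℕ+ → ℝ, (∀ n, 1 ≤ φ n) → Monotone φ →
        limsup (fun n : ℕ+ =>
          ((((n : ℕ) : ℝ) ^ (1 / p - 1) / (Real.log ((n : ℕ) : ℝ) * φ n) : ℝ) : EReal)) atTop = ⊤ →
        (¬ Vilenkin.BoundedHpLp (m := m) p (Vilenkin.maxNorlundLog φ)) ∧
          ∃ f ∈ Vilenkin.HardySpace m p, Vilenkin.lpQNorm p (Vilenkin.maxNorlundLog φ f) = ⊤ := by
  refine ⟨Vilenkin.boundedHpLp_maxNorlundLog_rpow m hm hp0 hp1, fun φ hφ hmono hlim => ?_⟩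
  obtain ⟨f, hf, htop⟩ :=
    Vilenkin.exists_hardy_maxNorlundLog_eq_top m hm hp0 hp1 hφ hmono hlim
  refine ⟨fun ⟨C, hC⟩ => ?_, f, hf, htop⟩
  exact (htop ▸ hC f hf).not_gt (ENNReal.mul_lt_top ENNReal.coe_lt_top hf.2)
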